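/- Let $G$ be a finite simple graph. Its cycle matroid $M(G)$ is the matroid on the edge set $E(G)$ whose circuits are the edge sets of the cycles of $G$. Its bicircular matroid $B(G)$ is the matroid on $E(G)$ whose circuits are the edge sets of the bicycles of $G$, that is, of the subgraphs of $G$ that are subdivisions of one of the following: two loops incident to the same vertex, two loops joined by an edge, or three edges joining the same pair of vertices. An automorphism of a matroid is a permutation $\varphi$ of its ground set such that, for every subset $C$, $\varphi(C)$ is a circuit if and only if $C$ is. A graph is $k$-connected if it has more than $k$ vertices and remains connected whenever fewer than $k$ vertices are deleted. (1) If $G$ is 3-connected, then $\mathrm{Aut}(G) \cong \mathrm{Aut}(M(G))$. (2) If $G$ is 2-connected with minimum degree at least 3 and has at least 5 vertices, then $\mathrm{Aut}(G) \cong \mathrm{Aut}(B(G))$. More precisely, in both cases the isomorphism is the natural one: it sends a graph automorphism $\sigma$ to the permutation $uv \mapsto \sigma(u)\sigma(v)$ of $E(G)$. -/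

import Mathlib

namespace SimpleGraph

section

variable {V : Type*}

/-- `C` is the edge set of a cycle of `G`. -/
def IsCycleEdgeSet (G : SimpleGraph V) (C : Set (Sym2 V)) : Prop :=
  ∃ (v : V) (p : G.Walk v v), p.IsCycle ∧ C = {e | e ∈ p.edges}

/-- `C` is the edge set of a theta graph in `G`: three paths with the same two distinct ends that
pairwise share no edge and no further vertex (a subdivision of three parallel edges). -/
def IsTheta (G : SimpleGraph V) (C : Set (Sym2 V)) : Prop :=
  ∃ (u v : V) (p q r : G.Walk u v), u ≠ v ∧ p.IsPath ∧ q.IsPath ∧ r.IsPath ∧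
    (∀ x, x ∈ p.support → x ∈ q.support → x = u ∨ x = v) ∧
    (∀ x, x ∈ p.support → x ∈ r.support → x = u ∨ x = v) ∧
    (∀ x, x ∈ q.support → x ∈ r.support → x = u ∨ x = v) ∧
    (∀ e, e ∈ p.edges → e ∉ q.edges) ∧
    (∀ e, e ∈ p.edges → e ∉ r.edges) ∧
    (∀ e, e ∈ q.edges → e ∉ r.edges) ∧
    C = {e | e ∈ p.edges ∨ e ∈ q.edges ∨ e ∈ r.edges}

/-- `C` is the edge set of two cycles of `G` with exactly one common vertex (a subdivision of two
loops at one vertex). -/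
def IsTightHandcuff (G : SimpleGraph V) (C : Set (Sym2 V)) : Prop :=
  ∃ (v : V) (p q : G.Walk v v), p.IsCycle ∧ q.IsCycle ∧
    (∀ x, x ∈ p.support → x ∈ q.support → x = v) ∧
    C = {e | e ∈ p.edges ∨ e ∈ q.edges}

/-- `C` is the edge set of two vertex-disjoint cycles of `G` together with a path that joins them and
meets each of them only in its end there (a subdivision of two loops joined by an edge). -/
def IsLooseHandcuff (G : SimpleGraph V) (C : Set (Sym2 V)) : Prop :=
  ∃ (u v : V) (p : G.Walk u u) (q : G.Walk v v) (r : G.Walk u v),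
    p.IsCycle ∧ q.IsCycle ∧ r.IsPath ∧
    (∀ x, x ∈ p.support → x ∉ q.support) ∧
    (∀ x, x ∈ p.support → x ∈ r.support → x = u) ∧
    (∀ x, x ∈ q.support → x ∈ r.support → x = v) ∧
    C = {e | e ∈ p.edges ∨ e ∈ q.edges ∨ e ∈ r.edges}

/-- `C` is the edge set of a bicycle of `G`. -/
def IsBicycle (G : SimpleGraph V) (C : Set (Sym2 V)) : Prop :=
  G.IsTightHandcuff C ∨ G.IsLooseHandcuff C ∨ G.IsTheta C

theorem IsCycleEdgeSet.mono {G H : SimpleGraph V} (h : H ≤ G) {C : Set (Sym2 V)}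
    (hC : H.IsCycleEdgeSet C) : G.IsCycleEdgeSet C := by
  obtain ⟨v, p, hp, rfl⟩ := hC
  exact ⟨v, p.mapLe h, hp.mapLe h, by simp⟩

theorem IsCycleEdgeSet.transfer {G H : SimpleGraph V} {C : Set (Sym2 V)}
    (hC : G.IsCycleEdgeSet C) (h : C ⊆ H.edgeSet) : H.IsCycleEdgeSet C := by
  obtain ⟨v, p, hp, rfl⟩ := hC
  have h' : ∀ e ∈ p.edges, e ∈ H.edgeSet := fun e he => h he
  exact ⟨v, p.transfer H h', hp.transfer h', by simp⟩

theorem IsBicycle.mono {G H : SimpleGraph V} (h : H ≤ G) {C : Set (Sym2 V)}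
    (hC : H.IsBicycle C) : G.IsBicycle C := by
  rcases hC with ⟨v, p, q, hp, hq, h1, rfl⟩ | ⟨u, v, p, q, r, hp, hq, hr, h1, h2, h3, rfl⟩ |
    ⟨u, v, p, q, r, huv, hp, hq, hr, h1, h2, h3, h4, h5, h6, rfl⟩
  · exact Or.inl ⟨v, p.mapLe h, q.mapLe h, hp.mapLe h, hq.mapLe h, by simpa using h1, by simp⟩
  · exact Or.inr (Or.inl ⟨u, v, p.mapLe h, q.mapLe h, r.mapLe h, hp.mapLe h, hq.mapLe h,
      hr.mapLe h, by simpa using h1, by simpa using h2, by simpa using h3, by simp⟩)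
  · exact Or.inr (Or.inr ⟨u, v, p.mapLe h, q.mapLe h, r.mapLe h, huv, hp.mapLe h, hq.mapLe h,
      hr.mapLe h, by simpa using h1, by simpa using h2, by simpa using h3,
      by simpa using h4, by simpa using h5, by simpa using h6, by simp⟩)

theorem card_connectedComponent_deleteEdges [Finite V] (H : SimpleGraph V) {u v : V}
    (hb : H.Adj u v) :
    Nat.card (H.deleteEdges {s(u, v)}).ConnectedComponent ≤ Nat.card H.ConnectedComponent + 1 ∧
    (¬ (H.deleteEdges {s(u, v)}).Reachable u v →
      Nat.card H.ConnectedComponent + 1 ≤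
        Nat.card (H.deleteEdges {s(u, v)}).ConnectedComponent) := by
  set K := H.deleteEdges {s(u, v)} with hK
  have hle : K ≤ H := deleteEdges_le _
  have key : ∀ x y, H.Reachable x y → K.Reachable x y ∨
      (K.Reachable x u ∧ K.Reachable y v) ∨ (K.Reachable x v ∧ K.Reachable y u) := by
    rintro x y ⟨w⟩
    induction w with
    | nil => exact Or.inl (Reachable.refl _)
    | @cons a b c hab w ih =>
      by_cases he : s(a, b) = s(u, v)
      · rw [Sym2.eq_iff] at he
        rcases he with ⟨rfl, rfl⟩ | ⟨rfl, rfl⟩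
        · rcases ih with h | ⟨h1, h2⟩ | ⟨h1, h2⟩
          · exact Or.inr (Or.inl ⟨Reachable.refl _, h.symm⟩)
          · exact Or.inr (Or.inl ⟨Reachable.refl _, h2⟩)
          · exact Or.inl h2.symm
        · rcases ih with h | ⟨h1, h2⟩ | ⟨h1, h2⟩
          · exact Or.inr (Or.inr ⟨Reachable.refl _, h.symm⟩)
          · exact Or.inl h2.symm
          · exact Or.inr (Or.inr ⟨Reachable.refl _, h2⟩)
      · have hK' : K.Adj a b := by
          rw [hK, deleteEdges_adj]; exact ⟨hab, by simpa using he⟩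
        rcases ih with h | ⟨h1, h2⟩ | ⟨h1, h2⟩
        · exact Or.inl (hK'.reachable.trans h)
        · exact Or.inr (Or.inl ⟨hK'.reachable.trans h1, h2⟩)
        · exact Or.inr (Or.inr ⟨hK'.reachable.trans h1, h2⟩)
  constructor
  · classical
    let f : K.ConnectedComponent → Option H.ConnectedComponent := fun c =>
      if c = K.connectedComponentMk v then none else some (c.map (Hom.ofLE hle))
    have hf : Function.Injective f := by
      intro c d
      induction c using ConnectedComponent.ind with | _ x
      induction d using ConnectedComponent.ind with | _ y
      simp only [f]
      split_ifs with h1 h2 h2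
      · intro _; exact h1.trans h2.symm
      · simp
      · simp
      · intro h
        simp only [Option.some.injEq, ConnectedComponent.map_mk, ConnectedComponent.eq] at h h1 h2 ⊢
        rcases key _ _ h with h | ⟨_, h⟩ | ⟨h, _⟩
        · exact h
        · exact absurd h h2
        · exact absurd h h1
    have := Nat.card_le_card_of_injective f hf
    simpa [Finite.card_option] using this
  · intro hn
    classical
    let g : K.ConnectedComponent → Option H.ConnectedComponent := fun c =>
      if c = K.connectedComponentMk v then none else some (c.map (Hom.ofLE hle))
    have hg : Function.Surjective g := by
      rintro (_ | c)
      · exact ⟨K.connectedComponentMk v, by simp [g]⟩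
      · induction c using ConnectedComponent.ind with | _ x
        by_cases hx : K.Reachable x v
        · refine ⟨K.connectedComponentMk u, ?_⟩
          have : K.connectedComponentMk u ≠ K.connectedComponentMk v := by
            rwa [Ne, ConnectedComponent.eq]
          simp only [g, this, if_false, Option.some.injEq, ConnectedComponent.map_mk,
            ConnectedComponent.eq]
          exact hb.reachable.trans (hx.mono hle).symm
        · refine ⟨K.connectedComponentMk x, ?_⟩
          have : K.connectedComponentMk x ≠ K.connectedComponentMk v := by
            rwa [Ne, ConnectedComponent.eq]
          simp only [g, this, if_false, Option.some.injEq, ConnectedComponent.map_mk,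
            ConnectedComponent.eq]
          exact Reachable.refl _
    have := Nat.card_le_card_of_surjective g hg
    simpa [Finite.card_option] using this

theorem card_le_ncard_edgeSet_add [Finite V] (H : SimpleGraph V) :
    Nat.card V ≤ H.edgeSet.ncard + Nat.card H.ConnectedComponent ∧
    (H.IsAcyclic → H.edgeSet.ncard + Nat.card H.ConnectedComponent ≤ Nat.card V) := by
  induction hn : H.edgeSet.ncard generalizing H with
  | zero =>
    have hH : H = ⊥ := by
      rw [Set.ncard_eq_zero (Set.toFinite _)] at hn
      exact edgeSet_eq_empty.1 hn
    subst hH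
    have hbij : Function.Bijective (fun v : V => (⊥ : SimpleGraph V).connectedComponentMk v) := by
      constructor
      · intro x y h
        simpa [ConnectedComponent.eq, reachable_bot] using h
      · intro c
        induction c using ConnectedComponent.ind with | _ x
        exact ⟨x, rfl⟩
    have := Nat.card_eq_of_bijective _ hbij
    omega
  | succ n ih =>
    have hne : H.edgeSet.Nonempty := by
      rw [← Set.ncard_pos (Set.toFinite _)]; omega
    obtain ⟨e, he⟩ := hne
    obtain ⟨u, v⟩ := e
    change s(u, v) ∈ H.edgeSet at he
    have hcard : (H.deleteEdges {s(u, v)}).edgeSet.ncard = n := by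
      rw [edgeSet_deleteEdges, Set.ncard_sdiff_singleton_of_mem he]; omega
    obtain ⟨i1, i2⟩ := ih _ hcard
    have hadj : H.Adj u v := he
    obtain ⟨j1, j2⟩ := card_connectedComponent_deleteEdges H hadj
    refine ⟨by omega, fun hac => ?_⟩
    have := i2 (hac.anti (deleteEdges_le _))
    have hbr := isAcyclic_iff_forall_isBridge.1 hac he
    have := j2 (by rw [isBridge_iff] at hbr; exact hbr)
    omega

theorem IsBicycle.subset_edgeSet {G : SimpleGraph V} {C : Set (Sym2 V)} (hC : G.IsBicycle C) :
    C ⊆ G.edgeSet := by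
  rcases hC with ⟨v, p, q, -, -, -, rfl⟩ | ⟨u, v, p, q, r, -, -, -, -, -, -, rfl⟩ |
    ⟨u, v, p, q, r, -, -, -, -, -, -, -, -, -, -, rfl⟩
  · rintro e (he | he) <;> exact Walk.edges_subset_edgeSet _ he
  · rintro e (he | he | he) <;> exact Walk.edges_subset_edgeSet _ he
  · rintro e (he | he | he) <;> exact Walk.edges_subset_edgeSet _ he

theorem IsBicycle.transfer {G H : SimpleGraph V} {C : Set (Sym2 V)}
    (hC : G.IsBicycle C) (h : C ⊆ H.edgeSet) : H.IsBicycle C := by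
  rcases hC with ⟨v, p, q, hp, hq, h1, rfl⟩ | ⟨u, v, p, q, r, hp, hq, hr, h1, h2, h3, rfl⟩ |
    ⟨u, v, p, q, r, huv, hp, hq, hr, h1, h2, h3, h4, h5, h6, rfl⟩
  · have hp' : ∀ e ∈ p.edges, e ∈ H.edgeSet := fun e he => h (Or.inl he)
    have hq' : ∀ e ∈ q.edges, e ∈ H.edgeSet := fun e he => h (Or.inr he)
    exact Or.inl ⟨v, p.transfer H hp', q.transfer H hq', hp.transfer hp', hq.transfer hq',
      by simpa using h1, by simp⟩
  · have hp' : ∀ e ∈ p.edges, e ∈ H.edgeSet := fun e he => h (Or.inl he)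
    have hq' : ∀ e ∈ q.edges, e ∈ H.edgeSet := fun e he => h (Or.inr (Or.inl he))
    have hr' : ∀ e ∈ r.edges, e ∈ H.edgeSet := fun e he => h (Or.inr (Or.inr he))
    exact Or.inr (Or.inl ⟨u, v, p.transfer H hp', q.transfer H hq', r.transfer H hr',
      hp.transfer hp', hq.transfer hq', hr.transfer hr', by simpa using h1, by simpa using h2,
      by simpa using h3, by simp⟩)
  · have hp' : ∀ e ∈ p.edges, e ∈ H.edgeSet := fun e he => h (Or.inl he)
    have hq' : ∀ e ∈ q.edges, e ∈ H.edgeSet := fun e he => h (Or.inr (Or.inl he))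
    have hr' : ∀ e ∈ r.edges, e ∈ H.edgeSet := fun e he => h (Or.inr (Or.inr he))
    exact Or.inr (Or.inr ⟨u, v, p.transfer H hp', q.transfer H hq', r.transfer H hr', huv,
      hp.transfer hp', hq.transfer hq', hr.transfer hr', by simpa using h1, by simpa using h2,
      by simpa using h3, by simpa using h4, by simpa using h5, by simpa using h6, by simp⟩)

theorem Walk.exists_first_hit {G : SimpleGraph V} (S : Set V) {x y : V} (w : G.Walk x y)
    (h : ∃ c ∈ w.support, c ∈ S) :
    ∃ z ∈ S, ∃ (p : G.Walk x z) (q : G.Walk z y), w = p.append q ∧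
      ∀ t ∈ p.support, t ∈ S → t = z := by
  induction w with
  | @nil u =>
    obtain ⟨c, hc, hcS⟩ := h
    simp only [Walk.support_nil, List.mem_singleton] at hc
    subst hc
    exact ⟨c, hcS, .nil, .nil, rfl, by simp⟩
  | @cons a b c hab w ih =>
    by_cases ha : a ∈ S
    · exact ⟨a, ha, .nil, .cons hab w, rfl, by simp⟩
    · obtain ⟨d, hd, hdS⟩ := h
      rw [Walk.support_cons, List.mem_cons] at hd
      have hd' : d ∈ w.support := hd.resolve_left (fun h => ha (h ▸ hdS))
      obtain ⟨z, hz, p, q, rfl, hpq⟩ := ih ⟨d, hd', hdS⟩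
      refine ⟨z, hz, .cons hab p, q, rfl, ?_⟩
      intro t ht htS
      rw [Walk.support_cons, List.mem_cons] at ht
      rcases ht with rfl | ht
      · exact absurd htS ha
      · exact hpq t ht htS

theorem Walk.edges_disjoint_of_common {G : SimpleGraph V} {a b c d z : V} (p : G.Walk a b)
    (q : G.Walk c d) (h : ∀ t ∈ p.support, t ∈ q.support → t = z) :
    ∀ e ∈ p.edges, e ∉ q.edges := by
  intro e hp hq
  obtain ⟨x, y⟩ := e
  have hadj : G.Adj x y := p.adj_of_mem_edges hp
  have h1 := h x (p.fst_mem_support_of_mem_edges hp) (q.fst_mem_support_of_mem_edges hq)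
  have h2 := h y (p.snd_mem_support_of_mem_edges hp) (q.snd_mem_support_of_mem_edges hq)
  exact hadj.ne (h1.trans h2.symm)

theorem Walk.exists_split_of_mem_edges {G : SimpleGraph V} {a b : V} (p : G.Walk a b)
    {e : Sym2 V} (he : e ∈ p.edges) :
    ∃ (x y : V) (h : G.Adj x y) (p₁ : G.Walk a x) (p₂ : G.Walk y b),
      e = s(x, y) ∧ p = p₁.append (.cons h p₂) := by
  induction p with
  | nil => simp at he
  | @cons u v w huv p ih =>
    rw [Walk.edges_cons, List.mem_cons] at he
    rcases he with rfl | he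
    · exact ⟨u, v, huv, .nil, p, rfl, rfl⟩
    · obtain ⟨x, y, h, p₁, p₂, rfl, rfl⟩ := ih he
      exact ⟨x, y, h, .cons huv p₁, p₂, rfl, rfl⟩

theorem Walk.IsCycle.exists_rotate {G : SimpleGraph V} {a c : V} {p : G.Walk a a}
    (hp : p.IsCycle) (hc : c ∈ p.support) :
    ∃ p' : G.Walk c c, p'.IsCycle ∧ (∀ t, t ∈ p'.support ↔ t ∈ p.support) ∧
      (∀ e, e ∈ p'.edges ↔ e ∈ p.edges) := by
  classical
  exact ⟨p.rotate c hc, hp.rotate hc, fun t => p.mem_support_rotate_iff c hc,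
    fun e => (p.rotate_edges c hc).mem_iff⟩

theorem exists_theta {H : SimpleGraph V} {a b : V} {p : H.Walk a a} {q : H.Walk b b}
    (hp : p.IsCycle) (hq : q.IsCycle) {e : Sym2 V} (heq : e ∈ q.edges) (hep : e ∉ p.edges)
    {c d : V} (hcd : c ≠ d) (hcp : c ∈ p.support) (hcq : c ∈ q.support)
    (hdp : d ∈ p.support) (hdq : d ∈ q.support) : ∃ D, H.IsTheta D := by
  classical
  obtain ⟨x, y, hxy, q₁, q₂, rfl, rfl⟩ := q.exists_split_of_mem_edges heq
  -- the path `y → x` left after removing the edge `s(x, y)` from the cycle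
  set r : H.Walk y x := q₂.append q₁ with hr
  have hrsupp : ∀ t, t ∈ (q₁.append (.cons hxy q₂)).support → t ∈ r.support := by
    intro t ht
    rw [hr, Walk.mem_support_append_iff]
    rw [Walk.mem_support_append_iff, Walk.support_cons, List.mem_cons] at ht
    rcases ht with h | rfl | h
    · exact Or.inr h
    · exact Or.inr (Walk.end_mem_support _)
    · exact Or.inl h
  have hrpath : r.IsPath := by
    rw [Walk.isPath_def, hr, Walk.support_append]
    have := hq.support_nodup
    rw [Walk.tail_support_append, Walk.support_cons, List.tail_cons] at this
    exact (List.perm_append_comm.nodup_iff).1 this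
  set S : Set V := {t | t ∈ p.support} with hS
  obtain ⟨z₁, hz₁, r₁, r', hrr, hr₁⟩ := r.exists_first_hit S ⟨c, hrsupp c hcq, hcp⟩
  obtain ⟨z₂, hz₂, s₁, s₂, hss, hs₁⟩ := r'.reverse.exists_first_hit S
    ⟨z₁, Walk.end_mem_support _, hz₁⟩
  have hr'path : r'.IsPath := by rw [hrr] at hrpath; exact hrpath.of_append_right
  have hr₁path : r₁.IsPath := by rw [hrr] at hrpath; exact hrpath.of_append_left
  have hs₁path : s₁.IsPath := by
    have := hr'path.reverse; rw [hss] at this; exact this.of_append_left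
  have hs₂path : s₂.IsPath := by
    have := hr'path.reverse; rw [hss] at this; exact this.of_append_right
  have hr'mem : ∀ t, t ∈ r'.support ↔ t ∈ s₁.support ∨ t ∈ s₂.support := by
    intro t
    rw [← Walk.mem_support_append_iff, ← hss, Walk.support_reverse, List.mem_reverse]
  have hz : z₁ ≠ z₂ := by
    intro h
    subst h
    have hnil : s₂ = .nil := Walk.eq_nil_iff_nil.2 (Walk.isPath_iff_nil.1 hs₂path)
    have hall : ∀ t, t ∈ (q₁.append (.cons hxy q₂)).support → t ∈ p.support → t = z₁ := by
      intro t ht htp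
      have h1 := hrsupp t ht
      rw [hrr, Walk.mem_support_append_iff, hr'mem] at h1
      rcases h1 with h1 | h1 | h1
      · exact hr₁ t h1 htp
      · exact hs₁ t h1 htp
      · subst hnil
        simpa using h1
    exact hcd ((hall c hcq hcp).trans (hall d hdq hdp).symm)
  have hdisj : ∀ t, t ∈ r₁.support → t ∉ s₁.support := by
    intro t ht1 ht2
    have h1 : t ∈ r'.support := (hr'mem t).2 (Or.inl ht2)
    have hnd := hrpath.support_nodup
    rw [hrr, Walk.support_append] at hnd
    rw [Walk.mem_support_iff] at h1
    rcases h1 with rfl | h1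
    · exact hz (hs₁ _ ht2 hz₁)
    · exact List.disjoint_of_nodup_append hnd ht1 h1
  set P : H.Walk z₁ z₂ := r₁.reverse.append (.cons hxy.symm s₁) with hP
  have hPmem : ∀ t, t ∈ P.support ↔ t ∈ r₁.support ∨ t ∈ s₁.support := by
    intro t
    rw [hP, Walk.mem_support_append_iff, Walk.support_cons, Walk.support_reverse,
      List.mem_reverse, List.mem_cons]
    constructor
    · rintro (h | rfl | h)
      · exact Or.inl h
      · exact Or.inl (Walk.start_mem_support _)
      · exact Or.inr h
    · rintro (h | h)
      · exact Or.inl h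
      · exact Or.inr (Or.inr h)
  have hPpath : P.IsPath := by
    rw [Walk.isPath_def, hP, Walk.support_append, Walk.support_cons, List.tail_cons,
      Walk.support_reverse, List.nodup_append]
    refine ⟨List.nodup_reverse.2 hr₁path.support_nodup, hs₁path.support_nodup, ?_⟩
    rintro t ht1 _ ht2 rfl
    exact hdisj t (List.mem_reverse.1 ht1) ht2
  have hPp : ∀ t, t ∈ P.support → t ∈ p.support → t = z₁ ∨ t = z₂ := by
    intro t ht htp
    rcases (hPmem t).1 ht with h | h
    · exact Or.inl (hr₁ t h htp)
    · exact Or.inr (hs₁ t h htp)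
  have hPe : ∀ f, f ∈ P.edges → f ∉ p.edges := by
    intro f hf hfp
    rw [hP, Walk.edges_append, List.mem_append, Walk.edges_cons, List.mem_cons,
      Walk.edges_reverse, List.mem_reverse] at hf
    rcases hf with hf | rfl | hf
    · exact Walk.edges_disjoint_of_common r₁ p hr₁ f hf hfp
    · exact hep (by rwa [Sym2.eq_swap])
    · exact Walk.edges_disjoint_of_common s₁ p hs₁ f hf hfp
  obtain ⟨p', hp', hps, hpe⟩ := hp.exists_rotate hz₁
  have hz₂' : z₂ ∈ p'.support := (hps _).2 hz₂
  set A := p'.takeUntil z₂ hz₂' with hA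
  set B := p'.dropUntil z₂ hz₂' with hB
  have hAB : A.append B = p' := Walk.take_spec _ _
  have hApath : A.IsPath := hp'.isPath_takeUntil hz₂'
  have hnd : (A.support.tail ++ B.support.tail).Nodup := by
    rw [← Walk.tail_support_append, hAB]; exact hp'.support_nodup
  have hABcommon : ∀ t, t ∈ A.support → t ∈ B.support → t = z₁ ∨ t = z₂ := by
    intro t h1 h2
    rw [Walk.mem_support_iff] at h1 h2
    rcases h1 with h1 | h1
    · exact Or.inl h1
    · rcases h2 with h2 | h2
      · exact Or.inr h2
      · exact absurd h2 (List.disjoint_of_nodup_append hnd h1)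
  have hBpath : B.IsPath := by
    rw [Walk.isPath_def, ← Walk.cons_tail_support, List.nodup_cons]
    refine ⟨?_, (List.nodup_append.1 hnd).2.1⟩
    have : z₂ ∈ A.support.tail := by
      have := Walk.end_mem_support A
      rw [Walk.mem_support_iff] at this
      exact this.resolve_left hz.symm
    exact List.disjoint_of_nodup_append hnd this
  have hABe : ∀ f, f ∈ A.edges → f ∉ B.edges := by
    have := hp'.isTrail.edges_nodup
    rw [← hAB, Walk.edges_append] at this
    exact fun f h1 h2 => List.disjoint_of_nodup_append this h1 h2
  have hAs : ∀ t, t ∈ A.support → t ∈ p.support := fun t ht =>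
    (hps t).1 (by rw [← hAB, Walk.mem_support_append_iff]; exact Or.inl ht)
  have hBs : ∀ t, t ∈ B.support → t ∈ p.support := fun t ht =>
    (hps t).1 (by rw [← hAB, Walk.mem_support_append_iff]; exact Or.inr ht)
  have hAe : ∀ t, t ∈ A.edges → t ∈ p.edges := fun t ht =>
    (hpe t).1 (by rw [← hAB, Walk.edges_append, List.mem_append]; exact Or.inl ht)
  have hBe : ∀ t, t ∈ B.edges → t ∈ p.edges := fun t ht =>
    (hpe t).1 (by rw [← hAB, Walk.edges_append, List.mem_append]; exact Or.inr ht)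
  refine ⟨_, z₁, z₂, A, B.reverse, P, hz, hApath, hBpath.reverse, hPpath, ?_, ?_, ?_, ?_, ?_, ?_,
    rfl⟩
  · intro t h1 h2
    exact hABcommon t h1 (by simpa using h2)
  · intro t h1 h2
    exact hPp t h2 (hAs t h1)
  · intro t h1 h2
    exact hPp t h2 (hBs t (by simpa using h1))
  · intro f h1 h2
    exact hABe f h1 (by simpa using h2)
  · intro f h1 h2
    exact hPe f h2 (hAe f h1)
  · intro f h1 h2
    exact hPe f h2 (hBe f (by simpa using h1))

/-- Two distinct cycles in one component of a graph force a bicycle. -/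
theorem exists_bicycle {H : SimpleGraph V} {a b : V} {p : H.Walk a a} {q : H.Walk b b}
    (hp : p.IsCycle) (hq : q.IsCycle) (hab : H.Reachable a b)
    {e : Sym2 V} (heq : e ∈ q.edges) (hep : e ∉ p.edges) : ∃ D, H.IsBicycle D := by
  classical
  by_cases h0 : ∃ c, c ∈ p.support ∧ c ∈ q.support
  · obtain ⟨c, hcp, hcq⟩ := h0
    by_cases h1 : ∃ d, d ≠ c ∧ d ∈ p.support ∧ d ∈ q.support
    · obtain ⟨d, hdc, hdp, hdq⟩ := h1
      obtain ⟨D, hD⟩ := exists_theta hp hq heq hep hdc hdp hdq hcp hcq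
      exact ⟨D, Or.inr (Or.inr hD)⟩
    · push Not at h1
      obtain ⟨p', hp', hps, -⟩ := hp.exists_rotate hcp
      obtain ⟨q', hq', hqs, -⟩ := hq.exists_rotate hcq
      refine ⟨_, Or.inl ⟨c, p', q', hp', hq', fun x hx hx' => ?_, rfl⟩⟩
      by_contra hxc
      exact h1 x hxc ((hps x).1 hx) ((hqs x).1 hx')
  · push Not at h0
    obtain ⟨w⟩ := hab
    obtain ⟨z, hz, w₁, -, -, hw₁⟩ := w.exists_first_hit {t | t ∈ q.support}
      ⟨b, Walk.end_mem_support _, Walk.start_mem_support q⟩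
    obtain ⟨y, hy, s₁, s₂, hs, hs₁⟩ := w₁.reverse.exists_first_hit {t | t ∈ p.support}
      ⟨a, Walk.end_mem_support _, Walk.start_mem_support p⟩
    have hsw : ∀ t, t ∈ s₁.support → t ∈ w₁.support := by
      intro t ht
      have : t ∈ w₁.reverse.support := by
        rw [hs, Walk.mem_support_append_iff]; exact Or.inl ht
      simpa using this
    obtain ⟨p', hp', hps, -⟩ := hp.exists_rotate hy
    obtain ⟨q', hq', hqs, -⟩ := hq.exists_rotate hz
    refine ⟨_, Or.inr (Or.inl ⟨y, z, p', q', s₁.bypass.reverse, hp', hq',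
      (Walk.bypass_isPath _).reverse, ?_, ?_, ?_, rfl⟩)⟩
    · intro x h1 h2
      exact h0 x ((hps x).1 h1) ((hqs x).1 h2)
    · intro x h1 h2
      exact hs₁ x (Walk.support_bypass_subset_support _ (by simpa using h2)) ((hps x).1 h1)
    · intro x h1 h2
      exact hw₁ x (hsw x (Walk.support_bypass_subset_support _ (by simpa using h2))) ((hqs x).1 h1)

/-- A graph without bicycles has at most as many edges as non-isolated vertices. -/
theorem ncard_edgeSet_le_of_no_bicycle [Finite V] (H : SimpleGraph V)
    (h : ∀ D, ¬ H.IsBicycle D) : H.edgeSet.ncard ≤ H.support.ncard := by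
  classical
  obtain ⟨F, hFH, hF, hreach⟩ := H.exists_isAcyclic_reachable_eq_le
  have h1 := (card_le_ncard_edgeSet_add F).2 hF
  have hcyc : ∀ e ∈ H.edgeSet \ F.edgeSet, ∃ (a : V) (p : H.Walk a a), p.IsCycle ∧
      a ∈ e ∧ e ∈ p.edges ∧ ∀ f ∈ p.edges, f = e ∨ f ∈ F.edgeSet := by
    rintro ⟨x, y⟩ ⟨heH, heF⟩
    change s(x, y) ∈ H.edgeSet at heH
    change s(x, y) ∉ F.edgeSet at heF
    have hadj : H.Adj x y := heH
    have hr : F.Reachable y x := by rw [hreach]; exact hadj.symm.reachable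
    obtain ⟨w, hw⟩ := hr.exists_isPath
    have hwe : ∀ f ∈ (w.mapLe hFH).edges, f ∈ F.edgeSet := by
      intro f hf
      rw [Walk.edges_mapLe_eq_edges] at hf
      exact w.edges_subset_edgeSet hf
    refine ⟨x, .cons hadj (w.mapLe hFH), ?_, Sym2.mem_mk_left x y, ?_, ?_⟩
    · rw [Walk.cons_isCycle_iff]
      exact ⟨hw.mapLe hFH, fun hc => heF (hwe _ hc)⟩
    · rw [Walk.edges_cons]; exact List.mem_cons_self
    · intro f hf
      rw [Walk.edges_cons, List.mem_cons] at hf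
      exact hf.imp id (hwe f)
  choose a p hp hae hep hpF using hcyc
  let φ : ↥(H.edgeSet \ F.edgeSet) ⊕ ↥(H.supportᶜ : Set V) → H.ConnectedComponent :=
    Sum.elim (fun e => H.connectedComponentMk (a e.1 e.2)) (fun v => H.connectedComponentMk v.1)
  have hiso : ∀ v ∈ (H.supportᶜ : Set V), ∀ w, H.Reachable v w → v = w := by
    rintro v hv w ⟨r⟩
    cases r with
    | nil => rfl
    | cons hvw _ => exact absurd (H.mem_support.2 ⟨_, hvw⟩) hv
  have hsupp : ∀ e, ∀ he : e ∈ H.edgeSet \ F.edgeSet, a e he ∈ H.support := by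
    intro e he
    have hae' := hae e he
    obtain ⟨b, hb⟩ := Sym2.mem_iff_exists.1 hae'
    have hE : H.Adj (a e he) b := by rw [← mem_edgeSet, ← hb]; exact he.1
    exact H.mem_support.2 ⟨b, hE⟩
  have hφ : Function.Injective φ := by
    rintro (⟨e, he⟩ | ⟨v, hv⟩) (⟨f, hf⟩ | ⟨w, hw⟩) heq
    · simp only [φ, Sum.elim_inl, ConnectedComponent.eq] at heq
      by_contra hne
      have hef : f ≠ e := fun hfe => hne (by subst hfe; rfl)
      have : f ∉ (p e he).edges := fun hmem => (hpF e he f hmem).elim hef hf.2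
      obtain ⟨D, hD⟩ := exists_bicycle (hp e he) (hp f hf) heq (hep f hf) this
      exact h D hD
    · simp only [φ, Sum.elim_inl, Sum.elim_inr, ConnectedComponent.eq] at heq
      exact absurd (hiso w hw _ heq.symm ▸ hsupp e he) hw
    · simp only [φ, Sum.elim_inl, Sum.elim_inr, ConnectedComponent.eq] at heq
      exact absurd (hiso v hv _ heq ▸ hsupp f hf) hv
    · simp only [φ, Sum.elim_inr, ConnectedComponent.eq] at heq
      have := hiso v hv w heq
      subst this
      rfl
  have h2 := Nat.card_le_card_of_injective φ hφ
  rw [Nat.card_sum, Nat.card_coe_set_eq, Nat.card_coe_set_eq,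
    Set.ncard_sdiff (edgeSet_mono hFH)] at h2
  have h3 := Set.ncard_add_ncard_compl H.support
  have h4 : Nat.card F.ConnectedComponent = Nat.card H.ConnectedComponent := by
    refine Nat.card_congr (Quot.congr (Equiv.refl V) ?_)
    intro x y
    rw [hreach]; rfl
  have h5 := Set.ncard_le_ncard (edgeSet_mono hFH) (Set.toFinite _)
  omega

/-- The vertices incident with some edge of `C`. -/
def incidentVerts (C : Set (Sym2 V)) : Set V := {v | ∃ e ∈ C, v ∈ e}

theorem Walk.mem_support_of_mem_mem_edges {G : SimpleGraph V} {a b t : V} {p : G.Walk a b}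
    {e : Sym2 V} (he : e ∈ p.edges) (ht : t ∈ e) : t ∈ p.support := by
  obtain ⟨y, rfl⟩ := Sym2.mem_iff_exists.1 ht
  exact p.fst_mem_support_of_mem_edges he

theorem IsBicycle.ncard_lt [Finite V] {G : SimpleGraph V} {C : Set (Sym2 V)}
    (hC : G.IsBicycle C) : (incidentVerts C).ncard < C.ncard := by
  classical
  have hcyc : ∀ {v : V} (p : G.Walk v v), p.IsCycle →
      p.support.toFinset.card = p.length ∧ p.edges.toFinset.card = p.length := by
    intro v p hp
    have h1 : p.support.toFinset = p.support.tail.toFinset := by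
      ext t
      rw [List.mem_toFinset, List.mem_toFinset, Walk.mem_support_iff]
      refine ⟨?_, Or.inr⟩
      rintro (rfl | h)
      · exact Walk.end_mem_tail_support hp.not_nil
      · exact h
    rw [h1, List.toFinset_card_of_nodup hp.support_nodup,
      List.toFinset_card_of_nodup hp.isTrail.edges_nodup, List.length_tail, Walk.length_support,
      Walk.length_edges]
    exact ⟨rfl, rfl⟩
  have hpath : ∀ {u v : V} (p : G.Walk u v), p.IsPath →
      p.support.toFinset.card = p.length + 1 ∧ p.edges.toFinset.card = p.length := by
    intro u v p hp
    rw [List.toFinset_card_of_nodup hp.support_nodup,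
      List.toFinset_card_of_nodup hp.isTrail.edges_nodup, Walk.length_support, Walk.length_edges]
    exact ⟨rfl, rfl⟩
  have hdisj : ∀ {a b c d : V} (p : G.Walk a b) (q : G.Walk c d),
      (∀ e, e ∈ p.edges → e ∉ q.edges) → Disjoint p.edges.toFinset q.edges.toFinset := by
    intro a b c d p q h
    rw [Finset.disjoint_left]
    intro e h1 h2
    exact h e (List.mem_toFinset.1 h1) (List.mem_toFinset.1 h2)
  have hsd : ∀ {a b u v : V} (r : G.Walk a b), u ≠ v → u ∈ r.support → v ∈ r.support →
      (r.support.toFinset \ {u, v}).card + 2 = r.support.toFinset.card := by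
    intro a b u v r huv hu hv
    have : ({u, v} : Finset V) ⊆ r.support.toFinset := by
      intro t ht
      simp only [Finset.mem_insert, Finset.mem_singleton] at ht
      rcases ht with rfl | rfl <;> simpa
    have h2 := Finset.card_sdiff_add_card_eq_card this
    rwa [Finset.card_pair huv] at h2
  rcases hC with ⟨v, p, q, hp, hq, h1, rfl⟩ | ⟨u, v, p, q, r, hp, hq, hr, h1, h2, h3, rfl⟩ |
    ⟨u, v, p, q, r, huv, hp, hq, hr, h1, h2, h3, h4, h5, h6, rfl⟩
  · have hE : ({e | e ∈ p.edges ∨ e ∈ q.edges} : Set (Sym2 V)) =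
        ↑(p.edges.toFinset ∪ q.edges.toFinset) := by ext; simp
    have hV : incidentVerts {e | e ∈ p.edges ∨ e ∈ q.edges} ⊆
        ↑(p.support.toFinset ∪ (q.support.toFinset.erase v)) := by
      rintro t ⟨e, he, ht⟩
      have hv := p.start_mem_support
      rcases he with he | he
      · have := Walk.mem_support_of_mem_mem_edges he ht
        simp [this]
      · have := Walk.mem_support_of_mem_mem_edges he ht
        by_cases htv : t = v
        · subst htv; simp
        · simp [this, htv]
    have hV' := Set.ncard_le_ncard hV (Finset.finite_toSet _)
    rw [Set.ncard_coe_finset] at hV'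
    refine lt_of_le_of_lt hV' ?_
    rw [hE, Set.ncard_coe_finset, Finset.card_union_of_disjoint
      (hdisj p q (Walk.edges_disjoint_of_common p q h1))]
    have h := Finset.card_union_le p.support.toFinset (q.support.toFinset.erase v)
    rw [Finset.card_erase_of_mem (by simp)] at h
    have := hcyc p hp
    have := hcyc q hq
    have := hq.three_le_length
    omega
  · have hu := p.start_mem_support
    have hv := q.start_mem_support
    have huv : u ≠ v := by rintro rfl; exact h1 u hu hv
    have hE : ({e | e ∈ p.edges ∨ e ∈ q.edges ∨ e ∈ r.edges} : Set (Sym2 V)) =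
        ↑((p.edges.toFinset ∪ q.edges.toFinset) ∪ r.edges.toFinset) := by ext; simp
    have hV : incidentVerts {e | e ∈ p.edges ∨ e ∈ q.edges ∨ e ∈ r.edges} ⊆
        ↑((p.support.toFinset ∪ q.support.toFinset) ∪ (r.support.toFinset \ {u, v})) := by
      rintro t ⟨e, he, ht⟩
      rcases he with he | he | he
      · have := Walk.mem_support_of_mem_mem_edges he ht
        simp [this]
      · have := Walk.mem_support_of_mem_mem_edges he ht
        simp [this]
      · have := Walk.mem_support_of_mem_mem_edges he ht
        by_cases htu : t = u
        · subst htu; simp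
        · by_cases htv : t = v
          · subst htv; simp
          · simp [this, htu, htv]
    have hV' := Set.ncard_le_ncard hV (Finset.finite_toSet _)
    rw [Set.ncard_coe_finset] at hV'
    have hd : Disjoint (p.edges.toFinset ∪ q.edges.toFinset) r.edges.toFinset := by
      rw [Finset.disjoint_union_left]
      exact ⟨hdisj _ _ (Walk.edges_disjoint_of_common p r h2),
        hdisj _ _ (Walk.edges_disjoint_of_common q r h3)⟩
    refine lt_of_le_of_lt hV' ?_
    rw [hE, Set.ncard_coe_finset, Finset.card_union_of_disjoint hd, Finset.card_union_of_disjoint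
      (hdisj p q (Walk.edges_disjoint_of_common (z := u) p q fun t a b => absurd b (h1 t a)))]
    · have h := Finset.card_union_le (p.support.toFinset ∪ q.support.toFinset)
        (r.support.toFinset \ {u, v})
      have h' := Finset.card_union_le p.support.toFinset q.support.toFinset
      have := hsd r huv r.start_mem_support r.end_mem_support
      have := hcyc p hp
      have := hcyc q hq
      have := hpath r hr
      omega
  · have hE : ({e | e ∈ p.edges ∨ e ∈ q.edges ∨ e ∈ r.edges} : Set (Sym2 V)) =
        ↑((p.edges.toFinset ∪ q.edges.toFinset) ∪ r.edges.toFinset) := by ext; simp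
    have hV : incidentVerts {e | e ∈ p.edges ∨ e ∈ q.edges ∨ e ∈ r.edges} ⊆
        ↑((p.support.toFinset ∪ (q.support.toFinset \ {u, v})) ∪
          (r.support.toFinset \ {u, v})) := by
      rintro t ⟨e, he, ht⟩
      by_cases htu : t = u
      · subst htu; simp
      by_cases htv : t = v
      · subst htv; simp
      rcases he with he | he | he <;>
      · have := Walk.mem_support_of_mem_mem_edges he ht
        simp [this, htu, htv]
    have hV' := Set.ncard_le_ncard hV (Finset.finite_toSet _)
    rw [Set.ncard_coe_finset] at hV'
    have hd : Disjoint (p.edges.toFinset ∪ q.edges.toFinset) r.edges.toFinset := by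
      rw [Finset.disjoint_union_left]
      exact ⟨hdisj _ _ h5, hdisj _ _ h6⟩
    refine lt_of_le_of_lt hV' ?_
    rw [hE, Set.ncard_coe_finset, Finset.card_union_of_disjoint hd, Finset.card_union_of_disjoint
      (hdisj p q h4)]
    · have h := Finset.card_union_le (p.support.toFinset ∪ (q.support.toFinset \ {u, v}))
        (r.support.toFinset \ {u, v})
      have h' := Finset.card_union_le p.support.toFinset (q.support.toFinset \ {u, v})
      have := hsd q huv q.start_mem_support q.end_mem_support
      have := hsd r huv r.start_mem_support r.end_mem_support
      have := hpath p hp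
      have := hpath q hq
      have := hpath r hr
      omega

theorem incidentVerts_mono {C D : Set (Sym2 V)} (h : C ⊆ D) :
    incidentVerts C ⊆ incidentVerts D := fun _ ⟨e, he, hv⟩ => ⟨e, h he, hv⟩

theorem incidentVerts_union (C D : Set (Sym2 V)) :
    incidentVerts (C ∪ D) = incidentVerts C ∪ incidentVerts D := by
  ext v
  constructor
  · rintro ⟨e, he | he, hv⟩
    · exact Or.inl ⟨e, he, hv⟩
    · exact Or.inr ⟨e, he, hv⟩
  · rintro (⟨e, he, hv⟩ | ⟨e, he, hv⟩)
    · exact ⟨e, Or.inl he, hv⟩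
    · exact ⟨e, Or.inr he, hv⟩

/-- A set of edges contains no bicycle if and only if each of its subsets has at most as many
edges as incident vertices. -/
theorem no_bicycle_iff [Finite V] {G : SimpleGraph V} {I : Set (Sym2 V)} (hI : I ⊆ G.edgeSet) :
    (∀ C, G.IsBicycle C → ¬ C ⊆ I) ↔ ∀ X ⊆ I, X.ncard ≤ (incidentVerts X).ncard := by
  constructor
  · intro h X hX
    have hXG : X ⊆ G.edgeSet := hX.trans hI
    have hE : (fromEdgeSet X).edgeSet = X := by
      rw [edgeSet_fromEdgeSet, sdiff_eq_left, Set.disjoint_left]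
      intro e he
      exact G.not_isDiag_of_mem_edgeSet (hXG he)
    have hle : fromEdgeSet X ≤ G := by rw [← edgeSet_subset_edgeSet, hE]; exact hXG
    have h1 := ncard_edgeSet_le_of_no_bicycle (fromEdgeSet X) (fun D hD =>
      h D (hD.mono hle) ((hE ▸ hD.subset_edgeSet).trans hX))
    have h2 : (fromEdgeSet X).support ⊆ incidentVerts X := by
      rintro v ⟨w, hw⟩
      exact ⟨s(v, w), ((fromEdgeSet_adj X).1 hw).1, Sym2.mem_mk_left v w⟩
    rw [hE] at h1
    exact h1.trans (Set.ncard_le_ncard h2 (Set.toFinite _))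
  · intro h C hC hCI
    exact absurd (h C hCI) (not_le.2 hC.ncard_lt)

theorem count_augment [Finite V] {I J : Set (Sym2 V)}
    (hI : ∀ X ⊆ I, X.ncard ≤ (incidentVerts X).ncard)
    (hJ : ∀ X ⊆ J, X.ncard ≤ (incidentVerts X).ncard) (hlt : I.ncard < J.ncard) :
    ∃ e ∈ J, e ∉ I ∧ ∀ X ⊆ insert e I, X.ncard ≤ (incidentVerts X).ncard := by
  classical
  by_contra hcon
  push Not at hcon
  have hfin : ∀ S : Set (Sym2 V), S.Finite := fun S => Set.toFinite S
  have hfinV : ∀ S : Set V, S.Finite := fun S => Set.toFinite S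
  -- tight subsets of `I` are closed under unions
  have hunion : ∀ X ⊆ I, ∀ Y ⊆ I, (incidentVerts X).ncard ≤ X.ncard →
      (incidentVerts Y).ncard ≤ Y.ncard → (incidentVerts (X ∪ Y)).ncard ≤ (X ∪ Y).ncard := by
    intro X hX Y hY h1 h2
    have e1 := Set.ncard_union_add_ncard_inter X Y (hfin _) (hfin _)
    have e2 := Set.ncard_union_add_ncard_inter (incidentVerts X) (incidentVerts Y)
      (hfinV _) (hfinV _)
    have e3 : (incidentVerts (X ∩ Y)).ncard ≤ (incidentVerts X ∩ incidentVerts Y).ncard :=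
      Set.ncard_le_ncard (Set.subset_inter (incidentVerts_mono Set.inter_subset_left)
        (incidentVerts_mono Set.inter_subset_right)) (hfinV _)
    have e4 := hI (X ∩ Y) (Set.inter_subset_left.trans hX)
    rw [incidentVerts_union]
    omega
  have hstep : ∀ S : Set (Sym2 V), S ⊆ J \ I → ∃ T ⊆ I,
      (incidentVerts T).ncard ≤ T.ncard ∧ incidentVerts S ⊆ incidentVerts T := by
    intro S
    induction S, hfin S using Set.Finite.induction_on with
    | empty =>
      intro _
      have h0 : incidentVerts (∅ : Set (Sym2 V)) = ∅ := by
        ext v; simp [incidentVerts]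
      exact ⟨∅, Set.empty_subset _, by simp [h0], by simp [h0]⟩
    | @insert e S _ _ ih =>
      intro hS
      obtain ⟨T, hTI, hT, hST⟩ := ih ((Set.subset_insert e S).trans hS)
      have he := hS (Set.mem_insert e S)
      obtain ⟨X, hX, hXlt⟩ := hcon e he.1 he.2
      have heX : e ∈ X := by
        by_contra heX
        exact absurd (hI X fun f hf => (hX hf).resolve_left (fun h => heX (h ▸ hf)))
          (not_le.2 hXlt)
      have hX'I : X \ {e} ⊆ I := fun f hf => (hX hf.1).resolve_left hf.2
      have h1 := hI _ hX'I
      have h2 := Set.ncard_sdiff_singleton_of_mem heX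
      have h3 : incidentVerts (X \ {e}) ⊆ incidentVerts X := incidentVerts_mono Set.sdiff_subset
      have h4 := Set.ncard_le_ncard h3 (hfinV _)
      have h5 : incidentVerts (X \ {e}) = incidentVerts X :=
        Set.eq_of_subset_of_ncard_le h3 (by omega) (hfinV _)
      refine ⟨T ∪ X \ {e}, Set.union_subset hTI hX'I,
        hunion _ hTI _ hX'I hT (by rw [h5]; omega), ?_⟩
      rw [incidentVerts_union, h5, Set.insert_eq, incidentVerts_union]
      refine Set.union_subset ?_ (hST.trans Set.subset_union_left)
      refine (incidentVerts_mono ?_).trans Set.subset_union_right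
      simpa using heX
  obtain ⟨T, hTI, hT, hJT⟩ := hstep (J \ I) subset_rfl
  have h1 := hJ (J ∩ (T ∪ J \ I)) Set.inter_subset_left
  have h2 : incidentVerts (J ∩ (T ∪ J \ I)) ⊆ incidentVerts T := by
    refine (incidentVerts_mono Set.inter_subset_right).trans ?_
    rw [incidentVerts_union]
    exact Set.union_subset subset_rfl hJT
  have h3 := Set.ncard_le_ncard h2 (hfinV _)
  have h4 : J ⊆ (J ∩ (T ∪ J \ I)) ∪ (I \ T) := by
    intro e he
    by_cases heI : e ∈ I
    · by_cases heT : e ∈ T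
      · exact Or.inl ⟨he, Or.inl heT⟩
      · exact Or.inr ⟨heI, heT⟩
    · exact Or.inl ⟨he, Or.inr ⟨he, heI⟩⟩
  have h5 := (Set.ncard_le_ncard h4 (hfin _)).trans (Set.ncard_union_le _ _)
  have h6 := Set.ncard_sdiff_add_ncard_of_subset hTI (hfin _)
  omega

theorem no_cycle_iff {G : SimpleGraph V} {I : Set (Sym2 V)} (hI : I ⊆ G.edgeSet) :
    (∀ C, G.IsCycleEdgeSet C → ¬ C ⊆ I) ↔ (fromEdgeSet I).IsAcyclic := by
  have hE : (fromEdgeSet I).edgeSet = I := by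
    rw [edgeSet_fromEdgeSet, sdiff_eq_left, Set.disjoint_left]
    intro e he
    exact G.not_isDiag_of_mem_edgeSet (hI he)
  have hle : fromEdgeSet I ≤ G := by rw [← edgeSet_subset_edgeSet, hE]; exact hI
  constructor
  · intro h v p hp
    refine h _ (IsCycleEdgeSet.mono hle ⟨v, p, hp, rfl⟩) ?_
    intro e he
    rw [← hE]
    exact p.edges_subset_edgeSet he
  · intro h C hC hCI
    obtain ⟨v, p, hp, -⟩ := hC.transfer (H := fromEdgeSet I) (by rwa [hE])
    exact h p hp

/-- The cycle matroid of a finite graph: the ground set is the edge set, and a set of edges is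
independent when it contains no cycle, so that the circuits are the edge sets of cycles. -/
def cycleMatroid [Finite V] (G : SimpleGraph V) : Matroid (Sym2 V) :=
  (IndepMatroid.ofFinite (E := G.edgeSet) (Set.toFinite _)
    (fun I => I ⊆ G.edgeSet ∧ ∀ C, G.IsCycleEdgeSet C → ¬ C ⊆ I)
    (by
      refine ⟨Set.empty_subset _, ?_⟩
      rintro C ⟨v, p, hp, rfl⟩ hC
      cases p with
      | nil => exact Walk.not_isCycle_nil hp
      | cons h p => exact hC (List.mem_cons_self (l := p.edges)))
    (fun I J hJ hIJ => ⟨hIJ.trans hJ.1, fun C hC hCI => hJ.2 C hC (hCI.trans hIJ)⟩)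
    (by
      rintro I J ⟨hI, hI'⟩ ⟨hJ, hJ'⟩ hlt
      by_contra hcon
      push Not at hcon
      have hE : ∀ K ⊆ G.edgeSet, (fromEdgeSet K).edgeSet = K := by
        intro K hK
        rw [edgeSet_fromEdgeSet, sdiff_eq_left, Set.disjoint_left]
        intro e he
        exact G.not_isDiag_of_mem_edgeSet (hK he)
      rw [no_cycle_iff hI] at hI'
      rw [no_cycle_iff hJ] at hJ'
      have hadj : ∀ x y, (fromEdgeSet J).Adj x y → (fromEdgeSet I).Reachable x y := by
        intro x y hxy
        rw [fromEdgeSet_adj] at hxy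
        by_cases hxI : s(x, y) ∈ I
        · exact Adj.reachable ((fromEdgeSet_adj I).2 ⟨hxI, hxy.2⟩)
        · by_contra hr
          have hins : insert s(x, y) I ⊆ G.edgeSet := Set.insert_subset (hJ hxy.1) hI
          obtain ⟨C, hC, hCI⟩ := hcon _ hxy.1 hxI hins
          refine (no_cycle_iff hins).2 ?_ C hC hCI
          have h1 := hI'.sup_edge_of_not_reachable hr
          have h2 : fromEdgeSet (insert s(x, y) I) = fromEdgeSet I ⊔ edge x y := by
            rw [edge, Set.insert_eq, ← fromEdgeSet_union, Set.union_comm]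
          rw [h2]
          exact h1
      have hreach : ∀ x y, (fromEdgeSet J).Reachable x y → (fromEdgeSet I).Reachable x y := by
        rintro x y ⟨w⟩
        induction w with
        | nil => exact Reachable.refl _
        | cons h _ ih => exact (hadj _ _ h).trans ih
      have hsurj : Function.Surjective
          (Quot.map id (fun x y h => hreach x y h) :
            (fromEdgeSet J).ConnectedComponent → (fromEdgeSet I).ConnectedComponent) := by
        intro c
        induction c using ConnectedComponent.ind with | _ x
        exact ⟨(fromEdgeSet J).connectedComponentMk x, rfl⟩
      have h1 : Nat.card (fromEdgeSet I).ConnectedComponent ≤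
          Nat.card (fromEdgeSet J).ConnectedComponent :=
        Nat.card_le_card_of_surjective _ hsurj
      have h2 := (card_le_ncard_edgeSet_add (fromEdgeSet I)).1
      have h3 := (card_le_ncard_edgeSet_add (fromEdgeSet J)).2 hJ'
      rw [hE I hI] at h2
      rw [hE J hJ] at h3
      omega)
    (fun I hI => hI.1)).matroid

/-- The bicircular matroid of a finite graph: the ground set is the edge set, and a set of edges
is independent when it contains no bicycle, so that the circuits are the edge sets of
bicycles. -/
def bicircularMatroid [Finite V] (G : SimpleGraph V) : Matroid (Sym2 V) :=
  (IndepMatroid.ofFinite (E := G.edgeSet) (Set.toFinite _)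
    (fun I => I ⊆ G.edgeSet ∧ ∀ C, G.IsBicycle C → ¬ C ⊆ I)
    (by
      refine ⟨Set.empty_subset _, (no_bicycle_iff (Set.empty_subset _)).2 ?_⟩
      intro X hX
      simp [Set.subset_empty_iff.1 hX])
    (fun I J hJ hIJ => ⟨hIJ.trans hJ.1, fun C hC hCI => hJ.2 C hC (hCI.trans hIJ)⟩)
    (by
      rintro I J ⟨hI, hI'⟩ ⟨hJ, hJ'⟩ hlt
      obtain ⟨e, heJ, heI, he⟩ :=
        count_augment ((no_bicycle_iff hI).1 hI') ((no_bicycle_iff hJ).1 hJ') hlt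
      have hins : insert e I ⊆ G.edgeSet := Set.insert_subset (hJ heJ) hI
      exact ⟨e, heJ, heI, hins, (no_bicycle_iff hins).2 he⟩)
    (fun I hI => hI.1)).matroid

/-- A graph is `k`-connected if it has more than `k` vertices and stays connected whenever fewer
than `k` vertices are deleted. -/
def IsKConnected [Finite V] (G : SimpleGraph V) (k : ℕ) : Prop :=
  k < Nat.card V ∧ ∀ S : Set V, S.ncard < k → (G.induce Sᶜ).Connected

end

end SimpleGraph

/-- The automorphism group of a matroid: the permutations of the ground set that preserve
circuits, in the sense that the image of a set is a circuit if and only if the set is. -/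
def Matroid.automorphismGroup {α : Type*} (M : Matroid α) : Subgroup (Equiv.Perm M.E) where
  carrier := {φ | ∀ C : Set M.E,
    M.IsCircuit (Subtype.val '' (φ '' C)) ↔ M.IsCircuit (Subtype.val '' C)}
  mul_mem' := by
    intro φ ψ hφ hψ C
    rw [← hψ C, ← hφ (ψ '' C), Set.image_image φ ψ]
    rfl
  one_mem' := by
    intro C
    have : ((1 : Equiv.Perm M.E) : M.E → M.E) '' C = C := by simp
    rw [this]
  inv_mem' := by
    intro φ hφ C
    have : φ '' ((φ⁻¹ : Equiv.Perm M.E) '' C) = C := by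
      rw [Set.image_image]; simp
    rw [← hφ ((φ⁻¹ : Equiv.Perm M.E) '' C), this]

/-!
A graph automorphism permutes the edges and preserves circuits, and it is determined by its action
on the edges because every vertex has two neighbours. What has to be shown is that every
automorphism `φ` of either matroid comes from a permutation of the vertices. It is enough that `φ`
permutes the vertex stars `δ(v)`, for an edge `uv` is the only edge in `δ(u) ∩ δ(v)`. To recognize
the stars, a family of edge sets is defined in terms of circuits alone, so that `φ` preserves it,
such that each member avoids some star and the complements of the stars are members; these
complements are then the maximal members (`SimpleGraph.exists_vertex_perm`). One star may be left
out, since an edge has an end at the remaining vertex exactly if it is in only one of the other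
stars.

*Cycle matroid.* The family consists of the proper flats that have no partition into two nonempty
parts such that each circuit of the flat lies in one of them. If such a set touched every vertex, it would form a connected spanning
graph and, being a flat, contain all edges (`SimpleGraph.exists_vert_avoided`). Conversely `G - v`
is 2-connected if `G` is 3-connected, and a 2-connected graph has no separation
(`SimpleGraph.eq_empty_or_eq_of_cycles_subset_or_disjoint`).

*Bicircular matroid.* The family consists of the unions of circuits that contain no independent set
with `|V|` elements. Independence means that the edges can be assigned injectively to their ends, so
Hall's theorem applies. The vertex set of a circuit can be saturated by its edges, and saturable
vertex sets are closed under unions; hence a union of circuits that touches every vertex has rank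
`|V|` (`SimpleGraph.exists_indep_ncard_eq`). Conversely, if the connected graph `G - v` has minimum
degree at least two and is not a cycle, then more than `|A|` of its edges touch a nonempty vertex
set `A`; by Hall's theorem `G - v` has full rank even after an edge is removed, so each of its edges
is in a circuit (`SimpleGraph.exists_isCircuit_avoiding`). If `G - v` is a cycle, then `G` is a wheel
with hub `v`, and as `G` has at least five vertices, this happens for at most one `v`: the
star left out.
-/

/-! ### Permutations of the edges that permute the vertex stars -/

/-- A permutation of `α` that preserves the family `𝓕` permutes the sets `st v` with `v ∈ X`, as
their complements are the maximal members of `𝓕`. -/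
theorem exists_perm_image_eq_of_family {α V : Type*} [Finite V] (st : V → Set α) (X : Set V)
    (𝓕 : Set α → Prop) (φ : Equiv.Perm α) (hφ : ∀ F, 𝓕 (φ '' F) ↔ 𝓕 F)
    (hmiss : ∀ F, 𝓕 F → ∃ v ∈ X, Disjoint F (st v)) (hst : ∀ v ∈ X, 𝓕 (st v)ᶜ)
    (hanti : ∀ v w, st v ⊆ st w → v = w) :
    ∃ σ : Equiv.Perm V, ∀ v ∈ X, φ '' st v = st (σ v) := by
  classical
  have key : ∀ ψ : Equiv.Perm α, (∀ F, 𝓕 (ψ '' F) ↔ 𝓕 F) →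
      ∀ v ∈ X, ∃ w ∈ X, st w ⊆ ψ '' st v := by
    intro ψ hψ v hv
    obtain ⟨w, hw, hd⟩ := hmiss _ ((hψ _).2 (hst v hv))
    refine ⟨w, hw, ?_⟩
    rw [Set.image_compl_eq ψ.bijective] at hd
    exact Set.disjoint_compl_left_iff_subset.1 hd
  have hφ' : ∀ F, 𝓕 ((φ⁻¹ : Equiv.Perm α) '' F) ↔ 𝓕 F := by
    intro F
    rw [← hφ, Set.image_image]
    simp
  have hex : ∀ v ∈ X, ∃ w ∈ X, φ '' st v = st w := by
    intro v hv
    obtain ⟨w, hw, h1⟩ := key φ hφ v hv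
    obtain ⟨u, -, h2⟩ := key φ⁻¹ hφ' w hw
    have h3 : (φ⁻¹ : Equiv.Perm α) '' st w ⊆ st v := by
      have := Set.image_mono (f := (φ⁻¹ : Equiv.Perm α)) h1
      rwa [Set.image_image, show (fun x => (φ⁻¹ : Equiv.Perm α) (φ x)) = id by ext; simp,
        Set.image_id] at this
    obtain rfl := hanti _ _ (h2.trans h3)
    refine ⟨w, hw, (Set.Subset.antisymm ?_ h1)⟩
    have := Set.image_mono (f := φ) h2
    rwa [Set.image_image, show (fun x => φ ((φ⁻¹ : Equiv.Perm α) x)) = id by ext; simp,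
      Set.image_id] at this
  choose! s hs hs' using hex
  -- `s` is extended from `X` to a permutation of all vertices by the identity
  let f : V → V := fun v => if v ∈ X then s v else v
  have hf : Function.Injective f := by
    intro v w h
    by_cases hv : v ∈ X <;> by_cases hw : w ∈ X <;> simp only [f, hv, hw, if_true, if_false] at h
    · have h1 : φ '' st v = φ '' st w := by rw [hs' v hv, hs' w hw, h]
      exact hanti _ _ (φ.injective.image_injective h1).subset
    · exact absurd (h ▸ hs v hv) hw
    · exact absurd (h ▸ hs w hw) hv
    · exact h
  refine ⟨Equiv.ofBijective f (Finite.injective_iff_bijective.1 hf), fun v hv => ?_⟩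
  simp only [Equiv.ofBijective_apply, f, hv, if_true]
  exact hs' v hv

namespace SimpleGraph

variable {V : Type*} {G : SimpleGraph V}

/-- The edges of `E` that are incident with `v`, as a set in the subtype `E`. -/
def edgeStar (E : Set (Sym2 V)) (v : V) : Set E := {e | v ∈ e.1}

theorem eq_of_star_subset (h2 : ∀ v, ∃ a b, a ≠ b ∧ G.Adj v a ∧ G.Adj v b) {v w : V}
    (h : edgeStar G.edgeSet v ⊆ edgeStar G.edgeSet w) : v = w := by
  obtain ⟨a, b, hab, ha, hb⟩ := h2 v
  have h3 : w ∈ s(v, a) := h (a := ⟨s(v, a), ha⟩) (Sym2.mem_mk_left v a)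
  have h4 : w ∈ s(v, b) := h (a := ⟨s(v, b), hb⟩) (Sym2.mem_mk_left v b)
  rw [Sym2.mem_iff] at h3 h4
  grind

/-- A permutation of the edges that preserves a family of edge sets whose members all miss a star,
and which contains the complements of all stars with at most one exception, comes from a
permutation of the vertices. -/
theorem exists_vertex_perm [Finite V] (h2 : ∀ v, ∃ a b, a ≠ b ∧ G.Adj v a ∧ G.Adj v b)
    {E : Set (Sym2 V)} (hE : E = G.edgeSet)
    (X : Set V) (hX : ∀ v ∉ X, ∀ w ∉ X, v = w) (𝓕 : Set E → Prop)
    (φ : Equiv.Perm E) (hφ : ∀ F, 𝓕 (φ '' F) ↔ 𝓕 F)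
    (hmiss : ∀ F, 𝓕 F → ∃ v ∈ X, Disjoint F (edgeStar E v))
    (hst : ∀ v ∈ X, 𝓕 (edgeStar E v)ᶜ) :
    ∃ σ : Equiv.Perm V, ∀ e : E, (φ e : Sym2 V) = Sym2.map σ e := by
  subst hE
  obtain ⟨σ, hσ⟩ := exists_perm_image_eq_of_family (edgeStar G.edgeSet) X 𝓕 φ hφ hmiss hst
    (fun v w => eq_of_star_subset h2)
  refine ⟨σ, ?_⟩
  have hmem : ∀ e : G.edgeSet, ∀ v ∈ X, (σ v ∈ (φ e : Sym2 V) ↔ v ∈ (e : Sym2 V)) := by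
    intro e v hv
    have h1 : φ e ∈ φ '' edgeStar G.edgeSet v ↔ σ v ∈ (φ e : Sym2 V) := by
      rw [hσ v hv]; rfl
    rw [← h1, φ.injective.mem_set_image]
    rfl
  have main : ∀ u w, ∀ h : G.Adj u w, u ∈ X →
      (φ ⟨s(u, w), h⟩ : Sym2 V) = s(σ u, σ w) := by
    intro u w h hu
    have h1 := (hmem ⟨s(u, w), h⟩ u hu).2 (Sym2.mem_mk_left u w)
    obtain ⟨y, hy⟩ := Sym2.mem_iff_exists.1 h1
    rw [hy]
    obtain ⟨z, rfl⟩ := σ.surjective y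
    have hadj : G.Adj (σ u) (σ z) := by
      rw [← mem_edgeSet, ← hy]; exact (φ _).2
    have hzu : z ≠ u := fun hzu => hadj.ne (by rw [hzu])
    suffices z = w by rw [this]
    -- if `z` and `w` are both outside `X`, then both are the exceptional vertex
    by_cases hz : z ∈ X
    · have h3 := (hmem ⟨s(u, w), h⟩ z hz).1 (by rw [hy]; exact Sym2.mem_mk_right _ _)
      exact (Sym2.mem_iff.1 h3).resolve_left hzu
    · by_cases hw : w ∈ X
      · have h3 := (hmem ⟨s(u, w), h⟩ w hw).2 (Sym2.mem_mk_right _ _)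
        rw [hy, Sym2.mem_iff, σ.injective.eq_iff, σ.injective.eq_iff] at h3
        exact (h3.resolve_left h.ne.symm).symm
      · exact hX z hz w hw
  rintro ⟨⟨u, w⟩, h⟩
  change G.Adj u w at h
  by_cases hu : u ∈ X
  · exact main u w h hu
  · have hw : w ∈ X := by
      by_contra hw
      exact h.ne (hX u hu w hw)
    have h3 := main w u h.symm hw
    have h4 : (⟨s(w, u), h.symm⟩ : G.edgeSet) = ⟨s(u, w), h⟩ := Subtype.ext Sym2.eq_swap
    rw [h4] at h3
    exact h3.trans Sym2.eq_swap

/-! ### Graph automorphisms as permutations of the edges -/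

/-- The action of the automorphisms of a graph on its edges. -/
def edgePerm (G : SimpleGraph V) : (G ≃g G) →* Equiv.Perm G.edgeSet where
  toFun σ := Iso.mapEdgeSet σ
  map_one' := by
    exact Equiv.ext fun e => Subtype.ext (congrFun Sym2.map_id _)
  map_mul' σ τ := by
    exact Equiv.ext fun e => Subtype.ext (Sym2.map_map (g := σ) (f := τ) e.1).symm

theorem edgePerm_injective (h2 : ∀ v, ∃ a b, a ≠ b ∧ G.Adj v a ∧ G.Adj v b) :
    Function.Injective (edgePerm G) := by
  intro σ τ h
  have h3 : ∀ u w, G.Adj u w → s(σ u, σ w) = s(τ u, τ w) := fun u w huw =>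
    congrArg (fun ψ : Equiv.Perm G.edgeSet => (ψ ⟨s(u, w), huw⟩ : Sym2 V)) h
  ext u
  obtain ⟨a, b, hab, ha, hb⟩ := h2 u
  have h4 := h3 u a ha
  have h5 := h3 u b hb
  have h6 : τ a ≠ τ b := fun h => hab (τ.injective h)
  rw [Sym2.eq_iff] at h4 h5
  grind

/-- A group of permutations of the edges of `G` that contains those induced by the automorphisms of
`G`, and each of whose elements is induced by a permutation of the vertices, is the automorphism
group of `G`. -/
theorem exists_mulEquiv_subgroup (h2 : ∀ v, ∃ a b, a ≠ b ∧ G.Adj v a ∧ G.Adj v b)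
    {E : Set (Sym2 V)} (hE : E = G.edgeSet) (A : Subgroup (Equiv.Perm E))
    (hA : ∀ (σ : G ≃g G) (ψ : Equiv.Perm E), (∀ e, (ψ e : Sym2 V) = Sym2.map σ e) → ψ ∈ A)
    (hperm : ∀ ψ ∈ A, ∃ σ : Equiv.Perm V, ∀ e : E, (ψ e : Sym2 V) = Sym2.map σ e) :
    ∃ Φ : (G ≃g G) ≃* A, ∀ (σ : G ≃g G) (e : E),
      (((Φ σ : Equiv.Perm E) e : E) : Sym2 V) = Sym2.map σ (e : Sym2 V) := by
  subst hE
  let f : (G ≃g G) →* A := (edgePerm G).codRestrict A fun σ => hA σ _ fun _ => rfl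
  have hf : Function.Bijective f := by
    refine ⟨fun σ τ h => edgePerm_injective h2 (congrArg Subtype.val h), ?_⟩
    rintro ⟨ψ, hψ⟩
    obtain ⟨σ, hσ⟩ := hperm ψ hψ
    have hadj : ∀ u w, G.Adj (σ u) (σ w) ↔ G.Adj u w := by
      intro u w
      constructor
      · intro h
        obtain ⟨e, he⟩ := ψ.surjective ⟨s(σ u, σ w), h⟩
        have h3 := hσ e
        rw [he] at h3
        have h4 : s(u, w) = e := Sym2.map.injective σ.injective h3
        rw [← mem_edgeSet, h4]
        exact e.2
      · intro h
        have h3 := (ψ ⟨s(u, w), h⟩).2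
        rw [hσ] at h3
        exact h3
    refine ⟨⟨σ, hadj _ _⟩, Subtype.ext (Equiv.ext fun e => Subtype.ext (hσ e).symm)⟩
  exact ⟨MulEquiv.ofBijective f hf, fun σ e => rfl⟩

/-! ### Independence and circuits in the bicircular matroid -/

theorem bicircularMatroid_indep_iff [Finite V] {I : Set (Sym2 V)} :
    G.bicircularMatroid.Indep I ↔
      I ⊆ G.edgeSet ∧ ∀ X ⊆ I, X.ncard ≤ (incidentVerts X).ncard := by
  have h : G.bicircularMatroid.Indep I ↔
      I ⊆ G.edgeSet ∧ ∀ C, G.IsBicycle C → ¬ C ⊆ I := by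
    rw [bicircularMatroid, IndepMatroid.matroid_indep_iff, IndepMatroid.ofFinite_indep]
  rw [h]
  exact and_congr_right fun hI => no_bicycle_iff hI

theorem _root_.Matroid.IsCircuit.incidentVerts_ncard_lt [Finite V] {C : Set (Sym2 V)}
    (hC : G.bicircularMatroid.IsCircuit C) : (incidentVerts C).ncard < C.ncard := by
  have hCE : C ⊆ G.edgeSet := hC.subset_ground
  have h := hC.not_indep
  rw [bicircularMatroid_indep_iff] at h
  push Not at h
  obtain ⟨X, hX, hlt⟩ := h hCE
  rcases hX.eq_or_ssubset with rfl | hX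
  · exact hlt
  · have := (bicircularMatroid_indep_iff.1 (hC.ssubset_indep hX)).2 X subset_rfl
    omega

theorem incidentVerts_image (σ : V → V) (X : Set (Sym2 V)) :
    incidentVerts (Sym2.map σ '' X) = σ '' incidentVerts X := by
  ext v
  simp only [incidentVerts, Set.mem_image, Set.mem_ofPred_eq, exists_exists_and_eq_and,
    Sym2.mem_map]
  grind

theorem isCircuit_image_bicircularMatroid [Finite V] (σ : G ≃g G) {C : Set (Sym2 V)}
    (hC : G.bicircularMatroid.IsCircuit C) :
    G.bicircularMatroid.IsCircuit (Sym2.map σ '' C) := by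
  have hinj : Function.Injective (Sym2.map σ) := Sym2.map.injective σ.injective
  have hE : ∀ X : Set (Sym2 V), Sym2.map σ '' X ⊆ G.edgeSet ↔ X ⊆ G.edgeSet := by
    intro X
    rw [Set.image_subset_iff]
    refine forall_congr' fun e => forall_congr' fun _ => ?_
    induction e with | _ x y
    exact σ.map_adj_iff
  have hI : ∀ X : Set (Sym2 V),
      G.bicircularMatroid.Indep (Sym2.map σ '' X) ↔ G.bicircularMatroid.Indep X := by
    intro X
    simp only [bicircularMatroid_indep_iff, Set.forall_subset_image_iff, hE,
      incidentVerts_image, Set.ncard_image_of_injective _ hinj,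
      Set.ncard_image_of_injective _ σ.injective]
  rw [Matroid.isCircuit_iff_forall_ssubset] at hC ⊢
  refine ⟨⟨(hI C).not.2 hC.1.not_indep, (hE C).2 hC.1.subset_ground⟩, fun X hX => ?_⟩
  obtain ⟨Y, hY, rfl⟩ := Set.subset_image_iff.1 hX.subset
  exact (hI Y).2 (hC.2 ((hinj.injOn.image_ssubset_image_iff (Set.subset_univ _) (Set.subset_univ _)).1 hX))

/-! ### Assigning edges to their ends -/

/-- **Hall's theorem** for vertices and incident edges. -/
theorem exists_injOn_incident [Finite V] (H : Set (Sym2 V)) (W : Set V)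
    (h : ∀ A ⊆ W, A.ncard ≤ {e ∈ H | ∃ x ∈ A, x ∈ e}.ncard) :
    ∃ m : V → Sym2 V, Set.InjOn m W ∧ ∀ x ∈ W, x ∈ m x ∧ m x ∈ H := by
  classical
  let t : W → Finset (Sym2 V) := fun x => (Set.toFinite {e ∈ H | x.1 ∈ e}).toFinset
  have ht : ∀ x e, e ∈ t x ↔ e ∈ H ∧ x.1 ∈ e := by simp [t]
  obtain ⟨f, hf, hft⟩ := (Finset.all_card_le_biUnion_card_iff_exists_injective t).1 (by
    intro s
    have h1 := h (Subtype.val '' (s : Set W)) (by rintro _ ⟨x, -, rfl⟩; exact x.2)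
    rw [Set.ncard_image_of_injective _ Subtype.val_injective, Set.ncard_coe_finset] at h1
    refine h1.trans (le_of_eq ?_)
    rw [← Set.ncard_coe_finset]
    congr 1
    ext e
    simp only [Set.mem_ofPred_eq, Set.mem_image, Finset.mem_coe, Finset.coe_biUnion, Set.mem_iUnion,
      ht]
    grind)
  refine ⟨fun x => if hx : x ∈ W then f ⟨x, hx⟩ else s(x, x), ?_, ?_⟩
  · intro x hx y hy hxy
    simp only [hx, hy, dif_pos] at hxy
    exact congrArg Subtype.val (hf hxy)
  · intro x hx
    simp only [hx, dif_pos]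
    exact ((ht _ _).1 (hft ⟨x, hx⟩)).symm

/-- Edges assigned injectively to their ends are independent in the bicircular matroid. -/
theorem indep_image_of_injOn [Finite V] {m : V → Sym2 V} {W : Set V} (hinj : Set.InjOn m W)
    (hm : ∀ x ∈ W, x ∈ m x ∧ m x ∈ G.edgeSet) : G.bicircularMatroid.Indep (m '' W) := by
  rw [bicircularMatroid_indep_iff]
  refine ⟨Set.image_subset_iff.2 fun x hx => (hm x hx).2, fun X hX => ?_⟩
  obtain ⟨A, hA, rfl⟩ := Set.subset_image_iff.1 hX
  rw [(hinj.mono hA).ncard_image]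
  exact Set.ncard_le_ncard (fun x hx => ⟨m x, Set.mem_image_of_mem m hx, (hm x (hA hx)).1⟩)
    (Set.toFinite _)

/-- `A` can be saturated by edges of `F` that join vertices of `A`: there are distinct such edges,
one at each vertex of `A`. -/
def Saturable (F : Set (Sym2 V)) (A : Set V) : Prop :=
  ∃ m : V → Sym2 V, Set.InjOn m A ∧ ∀ x ∈ A, x ∈ m x ∧ m x ∈ F ∧ ∀ y ∈ m x, y ∈ A

theorem Saturable.union {F : Set (Sym2 V)} {A B : Set V} (hA : Saturable F A)
    (hB : Saturable F B) : Saturable F (A ∪ B) := by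
  classical
  obtain ⟨m, hm, hm'⟩ := hA
  obtain ⟨k, hk, hk'⟩ := hB
  refine ⟨fun x => if x ∈ A then m x else k x, ?_, ?_⟩
  · intro x hx y hy hxy
    by_cases hxA : x ∈ A <;> by_cases hyA : y ∈ A <;>
      simp only [hxA, hyA, if_true, if_false] at hxy
    · exact hm hxA hyA hxy
    · exact absurd ((hm' x hxA).2.2 y (hxy ▸ (hk' y (hy.resolve_left hyA)).1)) hyA
    · exact absurd ((hm' y hyA).2.2 x (hxy ▸ (hk' x (hx.resolve_left hxA)).1)) hxA
    · exact hk (hx.resolve_left hxA) (hy.resolve_left hyA) hxy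
  · intro x hx
    by_cases hxA : x ∈ A
    · simp only [hxA, if_true]
      exact ⟨(hm' x hxA).1, (hm' x hxA).2.1, fun y hy => Or.inl ((hm' x hxA).2.2 y hy)⟩
    · have hxB := hx.resolve_left hxA
      simp only [hxA, if_false]
      exact ⟨(hk' x hxB).1, (hk' x hxB).2.1, fun y hy => Or.inr ((hk' x hxB).2.2 y hy)⟩

theorem Saturable.mono {F F' : Set (Sym2 V)} (h : F ⊆ F') {A : Set V} (hA : Saturable F A) :
    Saturable F' A := by
  obtain ⟨m, hm, hm'⟩ := hA
  exact ⟨m, hm, fun x hx => ⟨(hm' x hx).1, h (hm' x hx).2.1, (hm' x hx).2.2⟩⟩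

theorem saturable_incidentVerts [Finite V] {C : Set (Sym2 V)}
    (hC : G.bicircularMatroid.IsCircuit C) : Saturable C (incidentVerts C) := by
  obtain ⟨m, hm, hm'⟩ := exists_injOn_incident C (incidentVerts C) (by
    intro A hA
    rcases A.eq_empty_or_nonempty with rfl | ⟨a, ha⟩
    · simp
    set D := {e ∈ C | ∃ x ∈ A, x ∈ e}
    have hDC : D ⊆ C := Set.sep_subset _ _
    have hlt := hC.incidentVerts_ncard_lt
    -- the edges of the circuit that avoid `A` form a proper subset
    have hss : C \ D ⊂ C := by
      obtain ⟨e, he, hae⟩ := hA ha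
      exact ⟨Set.sdiff_subset, fun h => (h he).2 ⟨he, a, ha, hae⟩⟩
    have h1 := (bicircularMatroid_indep_iff.1 (hC.ssubset_indep hss)).2 _ subset_rfl
    have h2 : incidentVerts (C \ D) ⊆ incidentVerts C \ A := by
      rintro x ⟨e, he, hx⟩
      exact ⟨⟨e, he.1, hx⟩, fun hxA => he.2 ⟨he.1, x, hxA, hx⟩⟩
    have h3 := Set.ncard_le_ncard h2 (Set.toFinite _)
    have h4 := Set.ncard_sdiff_add_ncard_of_subset hA (Set.toFinite _)
    have h5 := Set.ncard_sdiff_add_ncard_of_subset hDC (Set.toFinite _)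
    omega)
  exact ⟨m, hm, fun x hx => ⟨(hm' x hx).1, (hm' x hx).2, fun y hy => ⟨_, (hm' x hx).2, hy⟩⟩⟩

/-- If every vertex is in a circuit contained in `F`, then `F` has full rank. -/
theorem exists_indep_ncard_eq [Finite V] {F : Set (Sym2 V)} (hFE : F ⊆ G.edgeSet)
    (hF : ∀ v, ∃ C ⊆ F, G.bicircularMatroid.IsCircuit C ∧ v ∈ incidentVerts C) :
    ∃ I ⊆ F, G.bicircularMatroid.Indep I ∧ I.ncard = Nat.card V := by
  have hS : ∀ S : Set V, ∃ A, S ⊆ A ∧ Saturable F A := by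
    intro S
    induction S, Set.toFinite S using Set.Finite.induction_on with
    | empty => exact ⟨∅, subset_rfl, fun x => s(x, x), by simp, by simp⟩
    | @insert v S _ _ ih =>
      obtain ⟨A, hSA, hA⟩ := ih
      obtain ⟨C, hCF, hC, hv⟩ := hF v
      refine ⟨incidentVerts C ∪ A, Set.insert_subset (Or.inl hv) (hSA.trans Set.subset_union_right),
        ((saturable_incidentVerts hC).mono hCF).union hA⟩
  obtain ⟨A, hA, m, hm, hm'⟩ := hS Set.univ
  obtain rfl := Set.univ_subset_iff.1 hA
  refine ⟨m '' Set.univ, Set.image_subset_iff.2 fun x hx => (hm' x hx).2.1,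
    indep_image_of_injOn hm fun x hx => ⟨(hm' x hx).1, hFE (hm' x hx).2.1⟩, ?_⟩
  rw [hm.ncard_image, Set.ncard_univ]

/-! ### Counting incidences -/

theorem sum_ncard_incident [Fintype V] [DecidableEq V] (D : Finset (Sym2 V)) (A : Finset V) :
    ∑ x ∈ A, {e | e ∈ D ∧ x ∈ e}.ncard = ∑ e ∈ D, (A.filter (· ∈ e)).card := by
  refine Eq.trans ?_
    (Finset.sum_card_bipartiteAbove_eq_sum_card_bipartiteBelow (fun (x : V) (e : Sym2 V) => x ∈ e))
  refine Finset.sum_congr rfl fun x _ => ?_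
  rw [← Set.ncard_coe_finset]
  congr 1
  ext e
  simp [Finset.bipartiteAbove]

theorem sum_ncard_incident_le [Finite V] (D : Set (Sym2 V)) (A : Finset V) :
    ∑ x ∈ A, {e ∈ D | x ∈ e}.ncard ≤ 2 * {e ∈ D | ∃ x ∈ A, x ∈ e}.ncard ∧
      ((∃ x ∈ A, ∃ y ∉ A, s(x, y) ∈ D) →
        ∑ x ∈ A, {e ∈ D | x ∈ e}.ncard < 2 * {e ∈ D | ∃ x ∈ A, x ∈ e}.ncard) := by
  classical
  have := Fintype.ofFinite V
  set T : Finset (Sym2 V) := {e ∈ D | ∃ x ∈ A, x ∈ e}.toFinset with hT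
  have hmem : ∀ e, e ∈ T ↔ e ∈ D ∧ ∃ x ∈ A, x ∈ e := by simp [hT]
  have hTn : {e ∈ D | ∃ x ∈ A, x ∈ e}.ncard = T.card := Set.ncard_eq_toFinset_card' _
  have hsum : ∑ x ∈ A, {e ∈ D | x ∈ e}.ncard = ∑ e ∈ T, (A.filter (· ∈ e)).card := by
    rw [← sum_ncard_incident]
    refine Finset.sum_congr rfl fun x hx => ?_
    congr 1
    ext e
    simp only [Set.mem_ofPred_eq, hmem]
    grind
  have hle : ∀ e ∈ T, (A.filter (· ∈ e)).card ≤ 2 := by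
    intro e _
    induction e with | _ u w
    refine (Finset.card_le_card (t := {u, w}) ?_).trans Finset.card_le_two
    intro x hx
    simpa using (Finset.mem_filter.1 hx).2
  rw [hTn, hsum, mul_comm, ← smul_eq_mul, ← Finset.sum_const]
  refine ⟨Finset.sum_le_sum hle, ?_⟩
  rintro ⟨x, hx, y, hy, hxy⟩
  refine Finset.sum_lt_sum hle ⟨s(x, y), ?_, ?_⟩
  · exact (hmem _).2 ⟨hxy, x, hx, Sym2.mem_mk_left x y⟩
  · refine lt_of_le_of_lt (Finset.card_le_card (t := {x}) ?_) (by simp)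
    intro z hz
    rw [Finset.mem_filter, Sym2.mem_iff] at hz
    grind

/-- Edge sets in which every vertex has degree at most two are independent in the bicircular
matroid, since they have at most as many edges as incident vertices. -/
theorem not_isCircuit_of_ncard_le_two [Finite V] {C : Set (Sym2 V)}
    (h : ∀ x, {e ∈ C | x ∈ e}.ncard ≤ 2) : ¬ G.bicircularMatroid.IsCircuit C := by
  classical
  have := Fintype.ofFinite V
  intro hC
  have hlt := hC.incidentVerts_ncard_lt
  have hCE : C ⊆ G.edgeSet := hC.subset_ground
  rw [Set.ncard_eq_toFinset_card', Set.ncard_eq_toFinset_card'] at hlt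
  have hsum := sum_ncard_incident C.toFinset (incidentVerts C).toFinset
  have h1 : ∀ e ∈ C.toFinset, ((incidentVerts C).toFinset.filter (· ∈ e)).card = 2 := by
    intro e he
    rw [Set.mem_toFinset] at he
    induction e with | _ u w
    have huw : u ≠ w := (hCE he : G.Adj u w).ne
    rw [← Finset.card_pair huw]
    congr 1
    ext x
    simp only [Finset.mem_filter, Set.mem_toFinset, Sym2.mem_iff, Finset.mem_insert,
      Finset.mem_singleton, and_iff_right_iff_imp]
    exact fun hx => ⟨s(u, w), he, Sym2.mem_iff.2 hx⟩
  have h2 : ∀ x ∈ (incidentVerts C).toFinset, {e | e ∈ C.toFinset ∧ x ∈ e}.ncard ≤ 2 := by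
    intro x _
    simpa using h x
  have h3 := Finset.sum_le_card_nsmul _ _ _ h2
  rw [hsum, Finset.sum_congr rfl h1, Finset.sum_const, smul_eq_mul, smul_eq_mul] at h3
  omega

/-! ### Vertex stars and the bicircular matroid -/

/-- The vertices `v` such that `G - v` has a vertex of degree at least three. -/
def branchingVerts (G : SimpleGraph V) : Set V :=
  {v | ∃ x ≠ v, 3 ≤ {e ∈ {e ∈ G.edgeSet | v ∉ e} | x ∈ e}.ncard}

theorem two_le_ncard_incident [Finite V] {v x : V} (hdeg : 3 ≤ {e ∈ G.edgeSet | x ∈ e}.ncard)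
    (hxv : x ≠ v) : 2 ≤ {e ∈ {e ∈ G.edgeSet | v ∉ e} | x ∈ e}.ncard := by
  have h : {e ∈ G.edgeSet | x ∈ e} ⊆
      insert s(x, v) {e ∈ {e ∈ G.edgeSet | v ∉ e} | x ∈ e} := by
    rintro e ⟨he, hx⟩
    by_cases hv : v ∈ e
    · exact Or.inl ((Sym2.mem_and_mem_iff hxv).1 ⟨hx, hv⟩)
    · exact Or.inr ⟨⟨he, hv⟩, hx⟩
  have h1 := Set.ncard_le_ncard h (Set.toFinite _)
  have h2 := Set.ncard_insert_le s(x, v) {e ∈ {e ∈ G.edgeSet | v ∉ e} | x ∈ e}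
  omega

theorem adj_of_notMem_branchingVerts [Finite V] {v x : V} (hv : v ∉ G.branchingVerts)
    (hdeg : 3 ≤ {e ∈ G.edgeSet | x ∈ e}.ncard) (hxv : x ≠ v) : G.Adj v x := by
  by_contra hadj
  refine hv ⟨x, hxv, hdeg.trans (Set.ncard_le_ncard ?_ (Set.toFinite _))⟩
  rintro e ⟨he, hx⟩
  refine ⟨⟨he, fun hve => hadj ?_⟩, hx⟩
  rw [(Sym2.mem_and_mem_iff hxv).1 ⟨hx, hve⟩] at he
  exact (show G.Adj x v from he).symm

theorem eq_of_notMem_branchingVerts [Finite V] (hcard : 5 ≤ Nat.card V)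
    (hdeg : ∀ x, 3 ≤ {e ∈ G.edgeSet | x ∈ e}.ncard) {v w : V} (hv : v ∉ G.branchingVerts)
    (hw : w ∉ G.branchingVerts) : v = w := by
  by_contra hvw
  refine hw ⟨v, hvw, ?_⟩
  -- `v` is adjacent to all vertices, so that its degree in `G - w` is `|V| - 2`
  have h : (fun y => s(v, y)) '' ({v, w} : Set V)ᶜ ⊆
      {e ∈ {e ∈ G.edgeSet | w ∉ e} | v ∈ e} := by
    rintro _ ⟨y, hy, rfl⟩
    rw [Set.mem_compl_iff, Set.mem_insert_iff, Set.mem_singleton_iff] at hy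
    refine ⟨⟨adj_of_notMem_branchingVerts hv (hdeg y) (by tauto), ?_⟩, Sym2.mem_mk_left v y⟩
    rw [Sym2.mem_iff]
    grind
  have h1 := Set.ncard_le_ncard h (Set.toFinite _)
  rw [Set.ncard_image_of_injective _ (fun a b hab => Sym2.congr_right.1 hab)] at h1
  have h2 := Set.ncard_add_ncard_compl ({v, w} : Set V)
  rw [Set.ncard_pair hvw] at h2
  omega

/-- In `G - v`, more than `|A|` edges meet a nonempty vertex set `A`: all degrees are at least two,
and `A` either is left by an edge or is everything, and then has a vertex of degree three. -/
theorem ncard_lt_ncard_incident [Finite V] {v : V} (hconn : (G.induce ({v} : Set V)ᶜ).Connected)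
    (hdeg : ∀ x, 3 ≤ {e ∈ G.edgeSet | x ∈ e}.ncard) (hv : v ∈ G.branchingVerts) {A : Set V}
    (hA : A ⊆ {v}ᶜ) (hne : A.Nonempty) :
    A.ncard < {e ∈ {e ∈ G.edgeSet | v ∉ e} | ∃ x ∈ A, x ∈ e}.ncard := by
  classical
  have := Fintype.ofFinite V
  obtain ⟨h1, h2⟩ := sum_ncard_incident_le {e ∈ G.edgeSet | v ∉ e} A.toFinset
  simp only [Set.mem_toFinset] at h1 h2
  have h3 : ∀ x ∈ A.toFinset, 2 ≤ {e ∈ {e ∈ G.edgeSet | v ∉ e} | x ∈ e}.ncard := fun x hx =>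
    two_le_ncard_incident (hdeg x) (hA (Set.mem_toFinset.1 hx))
  have h4 := Finset.card_nsmul_le_sum _ _ _ h3
  rw [← Set.ncard_eq_toFinset_card', smul_eq_mul] at h4
  by_cases hAv : A = {v}ᶜ
  · obtain ⟨x, hxv, hx⟩ := hv
    have h5 := Finset.sum_lt_sum h3 ⟨x, by simp [hAv, hxv], hx⟩
    rw [Finset.sum_const, ← Set.ncard_eq_toFinset_card', smul_eq_mul] at h5
    omega
  · obtain ⟨a, ha⟩ := hne
    obtain ⟨b, hbv, hb⟩ : ∃ b ∈ ({v} : Set V)ᶜ, b ∉ A := by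
      by_contra! h
      exact hAv (hA.antisymm h)
    obtain ⟨p⟩ := hconn.preconnected ⟨a, hA ha⟩ ⟨b, hbv⟩
    obtain ⟨d, -, hd1, hd2⟩ := p.exists_boundary_dart {x | x.1 ∈ A} ha hb
    have h6 := h2 ⟨d.fst, hd1, d.snd, hd2, d.adj, by
      rw [Sym2.mem_iff, not_or]
      exact ⟨Ne.symm d.fst.2, Ne.symm d.snd.2⟩⟩
    omega

theorem ncard_lt_of_indep [Finite V] {v : V} {I : Set (Sym2 V)}
    (hI : G.bicircularMatroid.Indep I) (hIv : ∀ e ∈ I, v ∉ e) : I.ncard < Nat.card V := by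
  have h1 := (bicircularMatroid_indep_iff.1 hI).2 I subset_rfl
  have h2 : incidentVerts I ⊆ {v}ᶜ := by
    rintro x ⟨e, he, hx⟩ rfl
    exact hIv e he hx
  have h3 := Set.ncard_le_ncard h2 (Set.toFinite _)
  have h4 := Set.ncard_add_ncard_compl ({v} : Set V)
  rw [Set.ncard_singleton] at h4
  omega

theorem exists_isCircuit_avoiding [Finite V] {v : V}
    (hconn : (G.induce ({v} : Set V)ᶜ).Connected)
    (hdeg : ∀ x, 3 ≤ {e ∈ G.edgeSet | x ∈ e}.ncard) (hv : v ∈ G.branchingVerts) {e : Sym2 V}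
    (he : e ∈ {e ∈ G.edgeSet | v ∉ e}) :
    ∃ C ⊆ {e ∈ G.edgeSet | v ∉ e}, G.bicircularMatroid.IsCircuit C ∧ e ∈ C := by
  set H := {e ∈ G.edgeSet | v ∉ e}
  obtain ⟨m, hm, hm'⟩ := exists_injOn_incident (H \ {e}) {v}ᶜ (by
    intro A hA
    rcases A.eq_empty_or_nonempty with rfl | hne
    · simp
    have h1 : A.ncard < {f ∈ H | ∃ x ∈ A, x ∈ f}.ncard :=
      ncard_lt_ncard_incident hconn hdeg hv hA hne
    have h2 : {f ∈ H | ∃ x ∈ A, x ∈ f} ⊆ insert e {f ∈ H \ {e} | ∃ x ∈ A, x ∈ f} := by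
      rintro f ⟨hf, hx⟩
      by_cases hfe : f = e
      · exact Or.inl hfe
      · exact Or.inr ⟨⟨hf, hfe⟩, hx⟩
    have h3 := Set.ncard_le_ncard h2 (Set.toFinite _)
    have h4 := Set.ncard_insert_le e {f ∈ H \ {e} | ∃ x ∈ A, x ∈ f}
    omega)
  set T := m '' {v}ᶜ with hT
  have hTH : T ⊆ H \ {e} := Set.image_subset_iff.2 fun x hx => (hm' x hx).2
  have hTI : G.bicircularMatroid.Indep T :=
    indep_image_of_injOn hm fun x hx => ⟨(hm' x hx).1, (hm' x hx).2.1.1⟩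
  have hTe : insert e T ⊆ H := Set.insert_subset he fun f hf => (hTH hf).1
  -- `T` already has as many edges as `G - v` has vertices
  have hdep : G.bicircularMatroid.Dep (insert e T) := by
    refine ⟨fun hI => ?_, hTe.trans (Set.sep_subset _ _)⟩
    have h1 := ncard_lt_of_indep hI fun f hf => (hTe hf).2
    rw [Set.ncard_insert_of_notMem (fun h => (hTH h).2 rfl) (Set.toFinite _), hT,
      hm.ncard_image] at h1
    have h4 := Set.ncard_add_ncard_compl ({v} : Set V)
    rw [Set.ncard_singleton] at h4
    omega
  obtain ⟨C, hC, hCc⟩ := hdep.exists_isCircuit_subset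
  refine ⟨C, hC.trans hTe, hCc, ?_⟩
  by_contra heC
  exact hCc.not_indep (hTI.subset fun f hf => (hC hf).resolve_left fun h => heC (h ▸ hf))

/-- A set of edges that is a union of circuits and not of full rank avoids a branching vertex. -/
theorem exists_branchingVert_avoided [Finite V] (hcard : 5 ≤ Nat.card V)
    (hdeg : ∀ x, 3 ≤ {e ∈ G.edgeSet | x ∈ e}.ncard) {F : Set (Sym2 V)} (hFE : F ⊆ G.edgeSet)
    (hF : ∀ e ∈ F, ∃ C ⊆ F, G.bicircularMatroid.IsCircuit C ∧ e ∈ C)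
    (hrank : ∀ I ⊆ F, G.bicircularMatroid.Indep I → I.ncard < Nat.card V) :
    ∃ v ∈ G.branchingVerts, ∀ e ∈ F, v ∉ e := by
  -- a union of circuits that touches all vertices has full rank
  obtain ⟨v, hv⟩ : ∃ v, ∀ e ∈ F, v ∉ e := by
    by_contra! h
    obtain ⟨I, hIF, hI, hIn⟩ := exists_indep_ncard_eq hFE (fun v => by
      obtain ⟨e, he, hve⟩ := h v
      obtain ⟨C, hCF, hC, heC⟩ := hF e he
      exact ⟨C, hCF, hC, e, heC, hve⟩)
    exact (hrank I hIF hI).ne hIn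
  by_cases hvX : v ∈ G.branchingVerts
  · exact ⟨v, hvX, hv⟩
  -- all degrees in `G - v` are at most two, so that it contains no circuit
  have hF0 : ∀ e, e ∉ F := by
    intro e he
    obtain ⟨C, hCF, hC, -⟩ := hF e he
    refine not_isCircuit_of_ncard_le_two (fun x => ?_) hC
    have h1 : {e ∈ C | x ∈ e} ⊆ {e ∈ {e ∈ G.edgeSet | v ∉ e} | x ∈ e} := fun f hf =>
      ⟨⟨hFE (hCF hf.1), hv f (hCF hf.1)⟩, hf.2⟩
    by_cases hxv : x = v
    · have : {e ∈ C | x ∈ e} = ∅ := by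
        ext f
        simpa using fun hf : f ∈ C => hxv ▸ hv f (hCF hf)
      simp [this]
    · by_contra! h2
      exact hvX ⟨x, hxv, Nat.lt_of_lt_of_le h2 (Set.ncard_le_ncard h1 (Set.toFinite _))⟩
  have : Nontrivial V := Finite.one_lt_card_iff_nontrivial.1 (by omega)
  obtain ⟨w, hw⟩ := exists_ne v
  refine ⟨w, ?_, fun e he => absurd he (hF0 e)⟩
  by_contra hwX
  exact hw (eq_of_notMem_branchingVerts hcard hdeg hwX hvX)

/-- An automorphism of the bicircular matroid preserves the unions of circuits that are not of full
rank. The maximal ones are the complements of the stars of the branching vertices. -/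
theorem exists_vertex_perm_of_mem_automorphismGroup_bicircularMatroid [Finite V]
    (h2 : ∀ v, ∃ a b, a ≠ b ∧ G.Adj v a ∧ G.Adj v b) (hG : G.IsKConnected 2)
    (hcard : 5 ≤ Nat.card V) (hdeg : ∀ x, 3 ≤ {e ∈ G.edgeSet | x ∈ e}.ncard)
    {φ : Equiv.Perm G.bicircularMatroid.E} (hφ : φ ∈ G.bicircularMatroid.automorphismGroup) :
    ∃ σ : Equiv.Perm V, ∀ e, (φ e : Sym2 V) = Sym2.map σ e := by
  have hE : G.bicircularMatroid.E = G.edgeSet := rfl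
  have hsub : ∀ D ⊆ G.bicircularMatroid.E, ∃ D' : Set G.bicircularMatroid.E,
      Subtype.val '' D' = D := fun D hD => ⟨Subtype.val ⁻¹' D, by simpa using hD⟩
  let K : Set G.bicircularMatroid.E → Prop := fun C =>
    G.bicircularMatroid.IsCircuit (Subtype.val '' C)
  have hK : ∀ C, K (φ '' C) ↔ K C := hφ
  have hind : ∀ I, (∀ C ⊆ I, ¬ K C) ↔ G.bicircularMatroid.Indep (Subtype.val '' I) := by
    intro I
    rw [Matroid.indep_iff_forall_subset_not_isCircuit (Subtype.coe_image_subset _ _)]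
    simp only [Set.forall_subset_image_iff, K]
  let 𝓕 : Set G.bicircularMatroid.E → Prop := fun F =>
    (∀ e ∈ F, ∃ C ⊆ F, K C ∧ e ∈ C) ∧ ∀ I ⊆ F, (∀ C ⊆ I, ¬ K C) → I.ncard < Nat.card V
  refine exists_vertex_perm h2 hE G.branchingVerts
    (fun v hv w hw => eq_of_notMem_branchingVerts hcard hdeg hv hw) 𝓕 φ ?_ ?_ ?_
  · intro F
    simp only [𝓕, Set.forall_mem_image, Set.exists_subset_image_iff, Set.forall_subset_image_iff,
      hK, φ.injective.mem_set_image, Set.ncard_image_of_injective _ φ.injective]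
  · rintro F ⟨hF1, hF2⟩
    obtain ⟨v, hv, hvF⟩ := exists_branchingVert_avoided (F := Subtype.val '' F) hcard hdeg
      (Subtype.coe_image_subset _ _) (by
        rintro _ ⟨e, he, rfl⟩
        obtain ⟨C, hCF, hC, heC⟩ := hF1 e he
        exact ⟨_, Set.image_mono hCF, hC, Set.mem_image_of_mem _ heC⟩) (by
        intro I hI hII
        obtain ⟨J, hJ, rfl⟩ := Set.subset_image_iff.1 hI
        rw [Set.ncard_image_of_injective _ Subtype.val_injective]
        exact hF2 J hJ ((hind J).2 hII))
    exact ⟨v, hv, Set.disjoint_left.2 fun e he => hvF e ⟨e, he, rfl⟩⟩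
  · intro v hv
    have hconn := hG.2 {v} (by simp)
    refine ⟨fun e he => ?_, fun I hI hII => ?_⟩
    · obtain ⟨C, hC, hCc, heC⟩ := exists_isCircuit_avoiding hconn hdeg hv ⟨e.2, he⟩
      obtain ⟨D, rfl⟩ := hsub C (hC.trans (Set.sep_subset _ _))
      refine ⟨D, fun f hf => (hC ⟨f, hf, rfl⟩).2, hCc, ?_⟩
      exact Subtype.val_injective.mem_set_image.1 heC
    · rw [← Set.ncard_image_of_injective _ Subtype.val_injective]
      refine ncard_lt_of_indep (v := v) ((hind I).1 hII) ?_
      rintro _ ⟨e, he, rfl⟩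
      exact hI he

/-! ### Circuits of the cycle matroid -/

theorem cycleMatroid_indep_iff [Finite V] {I : Set (Sym2 V)} :
    G.cycleMatroid.Indep I ↔ I ⊆ G.edgeSet ∧ ∀ C, G.IsCycleEdgeSet C → ¬ C ⊆ I := by
  rw [cycleMatroid, IndepMatroid.matroid_indep_iff, IndepMatroid.ofFinite_indep]

theorem Walk.IsPath.isAcyclic_fromEdgeSet {u v : V} {p : G.Walk u v} (hp : p.IsPath) :
    (fromEdgeSet {e | e ∈ p.edges}).IsAcyclic := by
  induction p with
  | nil => simp
  | @cons u v w h p ih =>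
    rw [Walk.cons_isPath_iff] at hp
    have hr : ¬ (fromEdgeSet {e | e ∈ p.edges}).Reachable u v := by
      rintro ⟨q⟩
      cases q with
      | nil => exact h.ne rfl
      | cons hq _ => exact hp.2 (p.fst_mem_support_of_mem_edges ((fromEdgeSet_adj _).1 hq).1)
    have h2 : fromEdgeSet {e | e ∈ (Walk.cons h p).edges} =
        fromEdgeSet {e | e ∈ p.edges} ⊔ edge u v := by
      rw [edge, ← fromEdgeSet_union]
      congr 1
      ext e
      simp
    rw [h2]
    exact (ih hp.1).sup_edge_of_not_reachable hr

/-- Removing an edge from a cycle leaves a path. -/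
theorem IsCycleEdgeSet.exists_isPath {C : Set (Sym2 V)} (hC : G.IsCycleEdgeSet C) {e : Sym2 V}
    (he : e ∈ C) : ∃ (x y : V) (r : G.Walk x y), x ≠ y ∧ e = s(x, y) ∧ r.IsPath ∧
      {f | f ∈ r.edges} = C \ {e} := by
  obtain ⟨v, p, hp, rfl⟩ := hC
  obtain ⟨x, y, hxy, p₁, p₂, rfl, rfl⟩ := p.exists_split_of_mem_edges he
  refine ⟨y, x, p₂.append p₁, hxy.ne.symm, Sym2.eq_swap, ?_, ?_⟩
  · rw [Walk.isPath_def, Walk.support_append]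
    have := hp.support_nodup
    rw [Walk.tail_support_append, Walk.support_cons, List.tail_cons] at this
    exact (List.perm_append_comm.nodup_iff).1 this
  · have h1 := hp.isTrail.edges_nodup
    rw [Walk.edges_append, Walk.edges_cons] at h1
    have h2 := (List.perm_middle.nodup_iff).1 h1
    rw [List.nodup_cons, List.mem_append] at h2
    ext f
    simp only [Walk.edges_append, Walk.edges_cons, List.mem_append, List.mem_cons,
      Set.mem_ofPred_eq, Set.mem_sdiff, Set.mem_singleton_iff]
    grind

theorem isCircuit_cycleMatroid_iff [Finite V] {C : Set (Sym2 V)} :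
    G.cycleMatroid.IsCircuit C ↔ G.IsCycleEdgeSet C := by
  have key : ∀ C, G.IsCycleEdgeSet C → G.cycleMatroid.IsCircuit C := by
    intro C hC
    have hCE : C ⊆ G.edgeSet := by
      obtain ⟨v, p, -, rfl⟩ := hC
      exact fun e he => p.edges_subset_edgeSet he
    rw [Matroid.isCircuit_iff_forall_ssubset]
    refine ⟨⟨fun hI => (cycleMatroid_indep_iff.1 hI).2 C hC subset_rfl, hCE⟩, fun X hX => ?_⟩
    obtain ⟨e, he, heX⟩ := Set.exists_of_ssubset hX
    obtain ⟨x, y, r, -, -, hr, hre⟩ := hC.exists_isPath he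
    refine cycleMatroid_indep_iff.2 ⟨hX.subset.trans hCE, fun D hD hDX => ?_⟩
    refine (no_cycle_iff (hre ▸ Set.sdiff_subset.trans hCE)).2 hr.isAcyclic_fromEdgeSet D hD ?_
    rw [hre]
    exact fun f hf => ⟨hX.subset (hDX hf), fun hfe => heX (hfe ▸ hDX hf)⟩
  refine ⟨fun hC => ?_, key C⟩
  have h := hC.not_indep
  rw [cycleMatroid_indep_iff] at h
  push Not at h
  obtain ⟨D, hD, hDC⟩ := h hC.subset_ground
  rwa [← (key D hD).eq_of_subset_isCircuit hC hDC]

theorem isCircuit_image_cycleMatroid [Finite V] (σ : G ≃g G) {C : Set (Sym2 V)}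
    (hC : G.cycleMatroid.IsCircuit C) : G.cycleMatroid.IsCircuit (Sym2.map σ '' C) := by
  rw [isCircuit_cycleMatroid_iff] at hC ⊢
  obtain ⟨v, p, hp, rfl⟩ := hC
  refine ⟨σ v, p.map σ.toHom, hp.map σ.injective, ?_⟩
  ext e
  simp [Walk.edges_map]

/-! ### Vertex stars and the cycle matroid -/

/-- A proper flat on which the cycle matroid is connected does not touch all vertices: otherwise
it would be the edge set of a connected spanning subgraph, whose closure is everything. -/
theorem exists_vert_avoided {F : Set (Sym2 V)} (hFE : F ⊂ G.edgeSet)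
    (hflat : ∀ C e, G.IsCycleEdgeSet C → e ∈ C → C \ {e} ⊆ F → e ∈ F)
    (hsep : ∀ P ⊆ F, (∀ C ⊆ F, G.IsCycleEdgeSet C → C ⊆ P ∨ Disjoint C P) → P = ∅ ∨ P = F) :
    ∃ v, ∀ e ∈ F, v ∉ e := by
  classical
  by_contra! h
  obtain ⟨e, he, heF⟩ := Set.exists_of_ssubset hFE
  induction e with | _ u v
  have huv : G.Adj u v := he
  set H := fromEdgeSet F with hH
  have hHE : H.edgeSet = F := by
    rw [hH, edgeSet_fromEdgeSet, sdiff_eq_left, Set.disjoint_left]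
    intro e he
    exact G.not_isDiag_of_mem_edgeSet (hFE.subset he)
  have hHG : H ≤ G := by rw [← edgeSet_subset_edgeSet, hHE]; exact hFE.subset
  -- the edges in the component of `u` are separated from the others
  have hP := hsep {e ∈ F | ∃ x ∈ e, H.Reachable u x} (Set.sep_subset _ _) (by
    intro C hCF hC
    obtain ⟨a, p, -, rfl⟩ := hC.transfer (hHE.symm ▸ hCF)
    have hpa : ∀ f ∈ p.edges, ∀ x ∈ f, H.Reachable a x := fun f hf x hx =>
      (p.takeUntil x (Walk.mem_support_of_mem_mem_edges hf hx)).reachable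
    by_cases hua : H.Reachable u a
    · refine Or.inl fun f hf => ⟨hCF hf, ?_⟩
      induction f with | _ x y
      exact ⟨x, Sym2.mem_mk_left x y, hua.trans (hpa _ hf x (Sym2.mem_mk_left x y))⟩
    · refine Or.inr (Set.disjoint_left.2 ?_)
      rintro f hf ⟨-, x, hx, hux⟩
      exact hua (hux.trans (hpa f hf x hx).symm))
  have hreach : H.Reachable u v := by
    rcases hP with hP | hP
    · obtain ⟨f, hf, huf⟩ := h u
      have : f ∈ {e ∈ F | ∃ x ∈ e, H.Reachable u x} := ⟨hf, u, huf, Reachable.refl _⟩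
      rw [hP] at this
      exact this.elim
    · obtain ⟨f, hf, hvf⟩ := h v
      rw [← hP] at hf
      obtain ⟨hf, x, hx, hux⟩ := hf
      by_cases hxv : x = v
      · exact hxv ▸ hux
      · rw [(Sym2.mem_and_mem_iff hxv).1 ⟨hx, hvf⟩] at hf
        exact hux.trans (Adj.reachable ((fromEdgeSet_adj F).2 ⟨hf, hxv⟩))
  obtain ⟨q, hq⟩ := hreach.symm.exists_isPath
  have hqF : ∀ f ∈ (q.mapLe hHG).edges, f ∈ F := by
    intro f hf
    rw [Walk.edges_mapLe_eq_edges] at hf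
    rw [← hHE]
    exact q.edges_subset_edgeSet hf
  refine heF (hflat {f | f ∈ (Walk.cons huv (q.mapLe hHG)).edges} _ ⟨u, _, ?_, rfl⟩ ?_ ?_)
  · exact Walk.cons_isCycle_iff _ _ |>.2 ⟨hq.mapLe hHG, fun hc => heF (hqF _ hc)⟩
  · simp
  · rintro f ⟨hf, hfe⟩
    exact hqF f ((List.mem_cons.1 hf).resolve_left hfe)

/-- A cycle through a vertex has at least two edges there. -/
theorem IsCycleEdgeSet.exists_mem_ne {C : Set (Sym2 V)} (hC : G.IsCycleEdgeSet C) {e : Sym2 V}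
    (he : e ∈ C) {v : V} (hv : v ∈ e) : ∃ f ∈ C, f ≠ e ∧ v ∈ f := by
  obtain ⟨x, y, r, hxy, rfl, -, hre⟩ := hC.exists_isPath he
  have hstart : ∀ {a b : V} (w : G.Walk a b), a ≠ b → ∃ f ∈ w.edges, a ∈ f := by
    intro a b w hab
    cases w with
    | nil => exact absurd rfl hab
    | cons h w => exact ⟨_, List.mem_cons_self, Sym2.mem_mk_left _ _⟩
  have : ∃ f ∈ r.edges, v ∈ f := by
    rcases Sym2.mem_iff.1 hv with rfl | rfl
    · exact hstart r hxy
    · obtain ⟨f, hf, hvf⟩ := hstart r.reverse hxy.symm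
      exact ⟨f, by simpa using hf, hvf⟩
  obtain ⟨f, hf, hvf⟩ := this
  have hf' : f ∈ C \ {s(x, y)} := hre ▸ hf
  exact ⟨f, hf'.1, hf'.2, hvf⟩

theorem exists_isPath_of_connected_induce {S : Set V} (hS : (G.induce S).Connected) {a b : V}
    (ha : a ∈ S) (hb : b ∈ S) : ∃ p : G.Walk a b, p.IsPath ∧ ∀ t ∈ p.support, t ∈ S := by
  obtain ⟨q, hq⟩ := (hS.preconnected ⟨a, ha⟩ ⟨b, hb⟩).exists_isPath
  refine ⟨q.map (Embedding.induce S).toHom, hq.map Subtype.val_injective, fun t ht => ?_⟩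
  obtain ⟨s, -, rfl⟩ := List.mem_map.1 ((Walk.support_map _ q) ▸ ht)
  exact s.2

/-- If `G - v` is 2-connected, then its cycle matroid is connected: at a vertex `x` that meets both
sides of a separation, two edges of different sides extend to a cycle through `G - v - x`. -/
theorem eq_empty_or_eq_of_cycles_subset_or_disjoint {v : V}
    (hv : (G.induce ({v} : Set V)ᶜ).Connected)
    (hvx : ∀ x, (G.induce ({v, x} : Set V)ᶜ).Connected) {P : Set (Sym2 V)}
    (hP : P ⊆ {e ∈ G.edgeSet | v ∉ e})
    (hsep : ∀ C ⊆ {e ∈ G.edgeSet | v ∉ e}, G.IsCycleEdgeSet C → C ⊆ P ∨ Disjoint C P) :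
    P = ∅ ∨ P = {e ∈ G.edgeSet | v ∉ e} := by
  by_contra! hcon
  obtain ⟨⟨e, he⟩, hne⟩ := hcon
  obtain ⟨f, hf, hfP⟩ := Set.exists_of_ssubset (hP.ssubset_of_ne hne)
  -- by connectedness, some vertex meets edges inside and outside `P`
  obtain ⟨x, a, b, ha, hb, hbP⟩ : ∃ x a b, s(x, a) ∈ P ∧
      s(x, b) ∈ {e ∈ G.edgeSet | v ∉ e} ∧ s(x, b) ∉ P := by
    by_contra! hno
    induction e with | _ c c'
    induction f with | _ d d'
    have hc : c ≠ v := fun h => (hP he).2 (h ▸ Sym2.mem_mk_left c c')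
    have hd : d ≠ v := fun h => hf.2 (h ▸ Sym2.mem_mk_left d d')
    obtain ⟨p⟩ := hv.preconnected ⟨c, hc⟩ ⟨d, hd⟩
    obtain ⟨t, -, ⟨z, hz⟩, ht⟩ := p.exists_boundary_dart {x | ∃ z, s(x.1, z) ∈ P} ⟨c', he⟩
      (fun ⟨z, hz⟩ => hfP (hno d z d' hz hf))
    refine ht ⟨t.fst, ?_⟩
    rw [Sym2.eq_swap]
    refine hno _ _ _ hz ⟨t.adj, ?_⟩
    rw [Sym2.mem_iff, not_or]
    exact ⟨Ne.symm t.fst.2, Ne.symm t.snd.2⟩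
  have hxa : G.Adj x a := (hP ha).1
  have hxb : G.Adj x b := hb.1
  have hav : a ≠ v := fun h => (hP ha).2 (h ▸ Sym2.mem_mk_right x a)
  have hbv : b ≠ v := fun h => hb.2 (h ▸ Sym2.mem_mk_right x b)
  have hxv : x ≠ v := fun h => hb.2 (h ▸ Sym2.mem_mk_left x b)
  have hab : a ≠ b := fun h => hbP (h ▸ ha)
  obtain ⟨p, hpp, hps⟩ := exists_isPath_of_connected_induce (hvx x) (a := a) (b := b)
    (by simp [hav, hxa.ne.symm]) (by simp [hbv, hxb.ne.symm])
  replace hps : ∀ t ∈ p.support, t ≠ v ∧ t ≠ x := fun t ht => by simpa using hps t ht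
  -- the path `p` from `a` to `b` closes up to a cycle through `x`
  have hcyc : (Walk.cons hxa (p.concat hxb.symm)).IsCycle := by
    rw [Walk.cons_isCycle_iff]
    refine ⟨hpp.concat (fun h => (hps x h).2 rfl) hxb.symm, fun h => ?_⟩
    rw [Walk.edges_concat, List.concat_eq_append, List.mem_append, List.mem_singleton] at h
    rcases h with h | h
    · exact (hps x (p.fst_mem_support_of_mem_edges h)).2 rfl
    · rw [Sym2.eq_iff] at h
      grind
  have hC := hsep _ (fun g hg => ⟨Walk.edges_subset_edgeSet _ hg, fun hvg => ?_⟩) ⟨x, _, hcyc, rfl⟩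
  · have hmema : s(x, a) ∈ {e | e ∈ (Walk.cons hxa (p.concat hxb.symm)).edges} := by simp
    have hmemb : s(x, b) ∈ {e | e ∈ (Walk.cons hxa (p.concat hxb.symm)).edges} := by
      simp [Walk.edges_concat, Sym2.eq_swap]
    rcases hC with hC | hC
    · exact hbP (hC hmemb)
    · exact Set.disjoint_left.1 hC hmema ha
  · have := Walk.mem_support_of_mem_mem_edges hg hvg
    rw [Walk.support_cons, Walk.support_concat, List.mem_cons, List.mem_append,
      List.mem_singleton] at this
    rcases this with h | h | h
    · exact hxv h.symm
    · exact (hps v h).1 rfl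
    · exact hxv h.symm

theorem exists_adj_of_connected_induce {S : Set V} (hS : (G.induce Sᶜ).Connected) {v w : V}
    (hv : v ∉ S) (hw : w ∉ S) (hvw : w ≠ v) : ∃ a ∉ S, G.Adj v a := by
  obtain ⟨p⟩ := hS.preconnected ⟨v, hv⟩ ⟨w, hw⟩
  obtain ⟨d, -, hd, -⟩ := p.exists_boundary_dart {x | x.1 = v} rfl hvw
  exact ⟨d.snd, d.snd.2, hd ▸ d.adj⟩

theorem IsKConnected.exists_adj_adj [Finite V] {k : ℕ} (hk : 2 ≤ k) (hG : G.IsKConnected k)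
    (v : V) : ∃ a b, a ≠ b ∧ G.Adj v a ∧ G.Adj v b := by
  have hcard := hG.1
  have hex : ∀ a, ∃ w, w ≠ v ∧ w ≠ a := by
    intro a
    by_contra! h
    have h1 : (Set.univ : Set V) ⊆ {v, a} := fun w _ => by
      by_cases hw : w = v
      · exact Or.inl hw
      · exact Or.inr (h w hw)
    have h2 := Set.ncard_le_ncard h1 (Set.toFinite _)
    have h3 := Set.ncard_insert_le v {a}
    rw [Set.ncard_singleton] at h3
    rw [Set.ncard_univ] at h2
    omega
  obtain ⟨w, hwv, -⟩ := hex v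
  obtain ⟨a, -, ha⟩ := exists_adj_of_connected_induce (hG.2 ∅ (by rw [Set.ncard_empty]; omega))
    (Set.notMem_empty v) (Set.notMem_empty w) hwv
  obtain ⟨w, hwv, hwa⟩ := hex a
  obtain ⟨b, hb, hvb⟩ := exists_adj_of_connected_induce
    (hG.2 {a} (by rw [Set.ncard_singleton]; omega)) (v := v) (w := w) ha.ne hwa hwv
  exact ⟨a, b, fun h => hb h.symm, ha, hvb⟩

/-- An automorphism of the cycle matroid preserves the proper flats on which the matroid is
connected. The maximal ones are the complements of the vertex stars. -/
theorem exists_vertex_perm_of_mem_automorphismGroup_cycleMatroid [Finite V]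
    (hG : G.IsKConnected 3) {φ : Equiv.Perm G.cycleMatroid.E}
    (hφ : φ ∈ G.cycleMatroid.automorphismGroup) :
    ∃ σ : Equiv.Perm V, ∀ e, (φ e : Sym2 V) = Sym2.map σ e := by
  have h2 := hG.exists_adj_adj (by norm_num)
  have hE : G.cycleMatroid.E = G.edgeSet := rfl
  have hsub : ∀ D ⊆ G.edgeSet, ∃ D' : Set G.cycleMatroid.E,
      Subtype.val '' D' = D := fun D hD => ⟨Subtype.val ⁻¹' D, by simpa [hE] using hD⟩
  have hinj : Function.Injective (Subtype.val : G.cycleMatroid.E → Sym2 V) :=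
    Subtype.val_injective
  let K : Set G.cycleMatroid.E → Prop := fun C => G.cycleMatroid.IsCircuit (Subtype.val '' C)
  have hK : ∀ C, K (φ '' C) ↔ K C := hφ
  let 𝓕 : Set G.cycleMatroid.E → Prop := fun F =>
    F ≠ Set.univ ∧ (∀ C e, K C → e ∈ C → C \ {e} ⊆ F → e ∈ F) ∧
      ∀ P ⊆ F, (∀ C ⊆ F, K C → C ⊆ P ∨ Disjoint C P) → P = ∅ ∨ P = F
  refine exists_vertex_perm h2 hE Set.univ (by simp) 𝓕 φ ?_ ?_ ?_
  · intro F
    refine and_congr ?_ (and_congr ?_ ?_)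
    · rw [Ne, Ne, ← φ.injective.image_injective.eq_iff (a := F), Set.image_univ,
        φ.range_eq_univ]
    · refine (Set.image_surjective.2 φ.surjective).forall.trans (forall_congr' fun C =>
        φ.surjective.forall.trans (forall_congr' fun e => ?_))
      rw [hK, φ.injective.mem_set_image, φ.injective.mem_set_image, ← Set.image_singleton,
        ← Set.image_sdiff φ.injective, Set.image_subset_image_iff φ.injective]
    · simp only [Set.forall_subset_image_iff, hK, Set.image_subset_image_iff φ.injective,
        Set.disjoint_image_iff φ.injective, Set.image_eq_empty,
        φ.injective.image_injective.eq_iff]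
  · rintro F ⟨hF1, hF2, hF3⟩
    obtain ⟨v, hv⟩ := exists_vert_avoided (G := G) (F := Subtype.val '' F) (by
        rw [← hE]
        refine (Subtype.coe_image_subset _ _).ssubset_of_ne fun h => hF1 ?_
        rw [← hinj.image_injective.eq_iff, h, Set.image_univ, Subtype.range_coe]) (by
        intro C e hC he hCF
        rw [← isCircuit_cycleMatroid_iff] at hC
        obtain ⟨D, rfl⟩ := hsub C hC.subset_ground
        obtain ⟨f, hf, rfl⟩ := he
        rw [← Set.image_singleton, ← Set.image_sdiff hinj, Set.image_subset_image_iff hinj] at hCF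
        exact ⟨f, hF2 D f hC hf hCF, rfl⟩) (by
        simp only [Set.forall_subset_image_iff, ← isCircuit_cycleMatroid_iff,
          Set.image_subset_image_iff hinj, Set.disjoint_image_iff hinj, Set.image_eq_empty,
          hinj.image_injective.eq_iff]
        exact hF3)
    exact ⟨v, Set.mem_univ v, Set.disjoint_left.2 fun e he => hv e ⟨e, he, rfl⟩⟩
  · intro v _
    have hstar : Subtype.val '' (edgeStar G.cycleMatroid.E v)ᶜ = {e ∈ G.edgeSet | v ∉ e} := by
      ext e
      constructor
      · rintro ⟨f, hf, rfl⟩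
        exact ⟨f.2, hf⟩
      · rintro ⟨he, hv⟩
        exact ⟨⟨e, he⟩, hv, rfl⟩
    refine ⟨fun h => ?_, fun C e hC he hCv => ?_, fun P hP hPC => ?_⟩
    · obtain ⟨a, -, -, ha, -⟩ := h2 v
      have : (⟨s(v, a), ha⟩ : G.cycleMatroid.E) ∈ (edgeStar G.cycleMatroid.E v)ᶜ := by
        rw [h]; exact Set.mem_univ _
      exact this (Sym2.mem_mk_left v a)
    · intro hve
      obtain ⟨_, ⟨f, hf, rfl⟩, hfe, hvf⟩ :=
        (isCircuit_cycleMatroid_iff.1 hC).exists_mem_ne (Set.mem_image_of_mem _ he) hve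
      exact hCv ⟨hf, fun h => hfe (congrArg _ h)⟩ hvf
    · have h3 := eq_empty_or_eq_of_cycles_subset_or_disjoint (P := Subtype.val '' P)
        (hG.2 {v} (by rw [Set.ncard_singleton]; omega))
        (fun x => hG.2 {v, x} (by
          have := Set.ncard_insert_le v {x}
          rw [Set.ncard_singleton] at this
          omega)) (by
          rw [← hstar]
          exact Set.image_mono hP) (by
          simp only [← hstar, Set.forall_subset_image_iff, ← isCircuit_cycleMatroid_iff,
            Set.image_subset_image_iff hinj, Set.disjoint_image_iff hinj]
          exact hPC)
      rwa [← hstar, Set.image_eq_empty, hinj.image_injective.eq_iff] at h3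

/-! ### Automorphism groups -/

/-- A matroid on the edges of `G` whose circuits are preserved by the automorphisms of `G`, and
whose automorphisms are all induced by permutations of the vertices, has the automorphism
group of `G`. -/
theorem exists_mulEquiv_automorphismGroup (h2 : ∀ v, ∃ a b, a ≠ b ∧ G.Adj v a ∧ G.Adj v b)
    {M : Matroid (Sym2 V)} (hE : M.E = G.edgeSet)
    (hC : ∀ (σ : G ≃g G) {C : Set (Sym2 V)}, M.IsCircuit C → M.IsCircuit (Sym2.map σ '' C))
    (hperm : ∀ φ ∈ M.automorphismGroup,
      ∃ σ : Equiv.Perm V, ∀ e : M.E, (φ e : Sym2 V) = Sym2.map σ e) :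
    ∃ Φ : (G ≃g G) ≃* M.automorphismGroup, ∀ (σ : G ≃g G) (e : M.E),
      (((Φ σ : Equiv.Perm M.E) e : M.E) : Sym2 V) = Sym2.map σ (e : Sym2 V) := by
  refine exists_mulEquiv_subgroup h2 hE _ (fun σ ψ hψ C => ?_) hperm
  have h : Subtype.val '' (ψ '' C) = Sym2.map σ '' (Subtype.val '' C) := by
    rw [Set.image_image, Set.image_image]
    exact Set.image_congr fun e _ => hψ e
  rw [h]
  refine ⟨fun h' => ?_, hC σ⟩
  have h3 := hC σ.symm h'
  rw [Set.image_image] at h3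
  have h4 : ∀ e : Sym2 V, Sym2.map σ.symm (Sym2.map σ e) = e := by
    intro e
    rw [Sym2.map_map, show (σ.symm ∘ σ : V → V) = id by ext; simp]
    exact congrFun Sym2.map_id e
  simpa only [h4, Set.image_id'] using h3

end SimpleGraph

theorem theorem4p4 {V : Type*} [Fintype V] (G : SimpleGraph V) [DecidableRel G.Adj] :
    (G.IsKConnected 3 →
      ∃ Φ : (G ≃g G) ≃* G.cycleMatroid.automorphismGroup,
        ∀ (σ : G ≃g G) (e : G.cycleMatroid.E),
          (((Φ σ : Equiv.Perm G.cycleMatroid.E) e : G.cycleMatroid.E) : Sym2 V) =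
            Sym2.map σ (e : Sym2 V)) ∧
    (G.IsKConnected 2 → 3 ≤ G.minDegree → 5 ≤ Fintype.card V →
      ∃ Φ : (G ≃g G) ≃* G.bicircularMatroid.automorphismGroup,
        ∀ (σ : G ≃g G) (e : G.bicircularMatroid.E),
          (((Φ σ : Equiv.Perm G.bicircularMatroid.E) e : G.bicircularMatroid.E) : Sym2 V) =
            Sym2.map σ (e : Sym2 V)) := by
  classical
  refine ⟨fun hG => ?_, fun hG hmin hcard => ?_⟩
  · exact SimpleGraph.exists_mulEquiv_automorphismGroup (hG.exists_adj_adj (by norm_num)) rfl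
      SimpleGraph.isCircuit_image_cycleMatroid fun φ hφ =>
        SimpleGraph.exists_vertex_perm_of_mem_automorphismGroup_cycleMatroid hG hφ
  · have h2 := hG.exists_adj_adj le_rfl
    have hdeg : ∀ x, 3 ≤ {e ∈ G.edgeSet | x ∈ e}.ncard := by
      intro x
      have h3 : (G.incidenceSet x).ncard = G.degree x := by
        rw [Set.ncard_eq_toFinset_card', Set.toFinset_card, SimpleGraph.card_incidenceSet_eq_degree]
      exact (hmin.trans (G.minDegree_le_degree x)).trans h3.ge
    exact SimpleGraph.exists_mulEquiv_automorphismGroup h2 rfl SimpleGraph.isCircuit_image_bicircularMatroid fun φ hφ =>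
      SimpleGraph.exists_vertex_perm_of_mem_automorphismGroup_bicircularMatroid h2 hG
        (by rwa [Nat.card_eq_fintype_card]) hdeg hφ
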